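/- Let $\Sigma$ be a closed connected oriented surface and let $\Gamma\subset\Sigma$ be a finite bipartite graph with at least one edge which partitions $\Sigma$ into topological disks (faces). Suppose that $\Gamma$ has equally many white and black vertices, and let $d\ge 2$. Call a family of points of a projective space a *circuit* if it is linearly dependent while each of its proper subfamilies is linearly independent. Fix *white data*: a point $A_w\in\mathbb P^d(\mathbb C)$ for every white vertex $w$, such that the points at the neighbors of any black vertex form a circuit (neighbors being counted once for every edge). Let $\mathcal B$ be the space of compatible *black data*: assignments of a hyperplane $\ell_b\subset\mathbb P^d$ to every black vertex $b$ such that * the hyperplanes at the neighbors of any white vertex form a circuit in the dual projective space, and * every face is coherent: if $A_1,\ell_1,\dots,A_n,\ell_n$ are the points and hyperplanes at its consecutive boundary vertices, then in terms of representing vectors and covectors $$\frac{\ell_1(A_1)\,\ell_2(A_2)\cdots\ell_n(A_n)}{\ell_1(A_2)\,\ell_2(A_3)\cdots\ell_n(A_1)}=1 .$$ View $\mathcal B$ as a subspace, with the Zariski topology, of the product of dual projective spaces over all black vertices. In homogeneous coordinates, $\mathcal B$ is given near each of its points by the following equations. For every white vertex of degree $m$, choose $m-1$ of the covectors at its neighbors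 and $m-1$ coordinates whose minor is nonzero at that point; the $d+2-m$ equations are the vanishing of the $m\times m$ minors obtained by adding the remaining covector and one further coordinate. In addition there is one coherence equation (numerator minus denominator of the ratio above equals zero) for every face except one, which may be omitted because its coherence follows from that of the others. Assume that $\mathcal B$ is nonempty and that these equations are independent, i.e. that the points of $\mathcal B$ at which their differentials are linearly independent, for some such choice, are Zariski dense in $\mathcal B$. Then $\dim\mathcal B=1-\chi(\Sigma)$, where $\chi(\Sigma)$ is the Euler characteristic. In particular, if $\Sigma$ is a torus, then $\dim\mathcal B=1$, i.e. $\mathcal B$ is a curve. -/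

import Mathlib

open scoped LinearAlgebra.Projectivization

noncomputable section

/-- A connected bipartite graph (multiple edges allowed) embedded in a closed connected oriented
surface so that all faces are topological disks, encoded by its rotation system. `E` is the set of
edges; `rotW e` (resp. `rotB e`) is the edge following `e` in the counterclockwise order around
the white (resp. black) endpoint of `e`. -/
structure BipartiteSurfaceGraph (E : Type*) where
  rotW : Equiv.Perm E
  rotB : Equiv.Perm E
  connected : ∀ e e' : E, ∃ g ∈ Subgroup.closure ({rotW, rotB} : Set (Equiv.Perm E)), g e = e'

namespace BipartiteSurfaceGraph

variable {E : Type*} (G : BipartiteSurfaceGraph E)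

/-- White vertices: the cycles of `rotW` (fixed points included). -/
def White : Type _ := Quotient (Equiv.Perm.SameCycle.setoid G.rotW)

/-- Black vertices: the cycles of `rotB` (fixed points included). -/
def Black : Type _ := Quotient (Equiv.Perm.SameCycle.setoid G.rotB)

/-- Walk along the edge `e` from its white to its black endpoint, with a face on the left, and
continue along the boundary of this face: one leaves the black endpoint along `rotB⁻¹ e`, and then
leaves the next white vertex along `rotW⁻¹ (rotB⁻¹ e)`. -/
def faceStep : Equiv.Perm E := G.rotW⁻¹ * G.rotB⁻¹

/-- Faces: the cycles of `faceStep`. A face which is a topological `2n`-gon is a cycle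
of length `n`. -/
def Face : Type _ := Quotient (Equiv.Perm.SameCycle.setoid G.faceStep)

/-- The white endpoint of an edge. -/
def white (e : E) : G.White := Quotient.mk _ e

/-- The black endpoint of an edge. -/
def black (e : E) : G.Black := Quotient.mk _ e

/-- The face on the left of an edge directed from white to black. -/
def face (e : E) : G.Face := Quotient.mk _ e

/-- The Euler characteristic of the surface: vertices minus edges plus faces. -/
def eulerChar : ℤ :=
  (Nat.card G.White + Nat.card G.Black : ℤ) - Nat.card E + Nat.card G.Face

/-- The edges at a white vertex. -/
abbrev WhiteStar (w : G.White) : Type _ := {e : E // G.white e = w}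

/-- The edges at a black vertex. -/
abbrev BlackStar (b : G.Black) : Type _ := {e : E // G.black e = b}

/-- The edges on the boundary of a face which, directed from white to black, have this face on
their left. -/
abbrev FaceEdges (F : G.Face) : Type _ := {e : E // G.face e = F}

end BipartiteSurfaceGraph

/-- A family of points in a projective space is a circuit if it is linearly dependent, while each
of its proper subfamilies is linearly independent. -/
def IsCircuit {ι K V : Type*} [Field K] [AddCommGroup V] [Module K V] (p : ι → ℙ K V) : Prop :=
  Projectivization.Dependent p ∧
    ∀ s : Set ι, s ≠ Set.univ → Projectivization.Independent fun i : s => p i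

/-- Points of complex projective `d`-space. -/
abbrev ProjPoint (d : ℕ) : Type := ℙ ℂ (Fin (d + 1) → ℂ)

/-- Hyperplanes of complex projective `d`-space, as points of the dual projective space: the class
of a nonzero covector `l` stands for the hyperplane `l = 0`. -/
abbrev ProjHyperplane (d : ℕ) : Type := ℙ ℂ (Module.Dual ℂ (Fin (d + 1) → ℂ))

namespace BipartiteSurfaceGraph

variable {E : Type*} (G : BipartiteSurfaceGraph E) {d : ℕ}

/-- A `d`-dimensional circuit configuration (white data): points attached to the white vertices,
such that the points at the neighbors of any black vertex form a circuit. -/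
def IsCircuitConfiguration (A : G.White → ProjPoint d) : Prop :=
  ∀ b : G.Black, IsCircuit fun e : G.BlackStar b => A (G.white e)

/-- All assignments of hyperplanes to black vertices. -/
def HyperplaneAssignment (d : ℕ) : Type _ := G.Black → ProjHyperplane d

/-- The hyperplanes at the neighbors of any white vertex form a circuit in the dual space. -/
def IsDualCircuitConfiguration (l : G.HyperplaneAssignment d) : Prop :=
  ∀ w : G.White, IsCircuit fun e : G.WhiteStar w => l (G.black e)

section
open Classical in
/-- The multi-ratio of the points and hyperplanes `A₁, l₁, …, Aₙ, lₙ` at the consecutive vertices of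
a face, that is `l₁(A₁) ⋯ lₙ(Aₙ) / (l₁(A₂) ⋯ lₙ(A₁))`, computed through representatives.
It is `0` by convention if the denominator vanishes. -/
def multiRatio [Fintype E] (A : G.White → ProjPoint d) (l : G.HyperplaneAssignment d)
    (F : G.Face) : ℂ :=
  (∏ e : G.FaceEdges F, (l (G.black e)).rep (A (G.white e)).rep) /
    ∏ e : G.FaceEdges F, (l (G.black e)).rep (A (G.white (G.faceStep e))).rep
end

/-- All faces are coherent: their multi-ratios are equal to `1`. -/
def IsCoherent [Fintype E] (A : G.White → ProjPoint d) (l : G.HyperplaneAssignment d) : Prop :=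
  ∀ F : G.Face, G.multiRatio A l F = 1

/-- The space of black data compatible with the white data `A`: together they form a coherent
double circuit configuration. -/
def compatibleBlackData [Fintype E] (A : G.White → ProjPoint d) : Set (G.HyperplaneAssignment d) :=
  {l | IsCircuitConfiguration G A ∧ IsDualCircuitConfiguration G l ∧ G.IsCoherent A l}

/-! ### The Zariski topology on assignments of hyperplanes -/

/-- Indices of the homogeneous coordinates of all the hyperplanes. -/
abbrev CoordIndex (d : ℕ) : Type _ := G.Black × Fin (d + 1)

/-- Homogeneous coordinates of an assignment of hyperplanes (for the chosen representatives). -/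
def homogCoord (l : G.HyperplaneAssignment d) (v : G.CoordIndex d) : ℂ :=
  (l v.1).rep (Pi.single v.2 1)

section
open Classical in
/-- Multihomogeneous polynomials of multidegree `n`: homogeneous of degree `n b` in the coordinates
of the hyperplane at `b`, for each `b`. -/
def IsMultihomogeneous (P : MvPolynomial (G.CoordIndex d) ℂ) (n : G.Black → ℕ) : Prop :=
  MvPolynomial.IsWeightedHomogeneous
    (fun v : G.CoordIndex d => (Pi.single v.1 1 : G.Black → ℕ)) P n
end

/-- The Zariski topology of a product of projective spaces: the non-vanishing loci of
multihomogeneous polynomials form a basis of open sets. -/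
instance : TopologicalSpace (G.HyperplaneAssignment d) :=
  TopologicalSpace.generateFrom
    {U | ∃ (P : MvPolynomial (G.CoordIndex d) ℂ) (n : G.Black → ℕ), G.IsMultihomogeneous P n ∧
      U = {l | MvPolynomial.eval (G.homogCoord l) P ≠ 0}}

/-! ### The equations on black data -/

section
open Classical in
/-- The pivot minor of a choice of an edge `e₀` at `w` and of a coordinate `c e` for each other
edge `e` at `w`: the determinant of these coordinates of the covectors at the other
neighbors of `w`. -/
def pivotMinor [Fintype E] (w : G.White) (e₀ : G.WhiteStar w)
    (c : {e : G.WhiteStar w // e ≠ e₀} → Fin (d + 1)) : MvPolynomial (G.CoordIndex d) ℂ :=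
  (Matrix.of fun e e' : {e : G.WhiteStar w // e ≠ e₀} =>
    (MvPolynomial.X (G.black e.1, c e') : MvPolynomial (G.CoordIndex d) ℂ)).det

open Classical in
/-- The bordered minor: add the covector at `e₀` and the coordinate `j` to the pivot minor. -/
def borderedMinor [Fintype E] (w : G.White) (e₀ : G.WhiteStar w)
    (c : {e : G.WhiteStar w // e ≠ e₀} → Fin (d + 1)) (j : Fin (d + 1)) :
    MvPolynomial (G.CoordIndex d) ℂ :=
  (Matrix.of fun e e' : G.WhiteStar w =>
    (MvPolynomial.X (G.black e, if h : e' = e₀ then j else c ⟨e', h⟩) :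
      MvPolynomial (G.CoordIndex d) ℂ)).det

/-- The linear form in the coordinates of the hyperplane at `b` which is the value at
the vector `a`. -/
def pairingPoly (b : G.Black) (a : Fin (d + 1) → ℂ) : MvPolynomial (G.CoordIndex d) ℂ :=
  ∑ i, MvPolynomial.C (a i) * MvPolynomial.X (b, i)

open Classical in
/-- The coherence equation of a face: numerator minus denominator of the multi-ratio. -/
def coherencePoly [Fintype E] (A : G.White → ProjPoint d) (F : G.Face) :
    MvPolynomial (G.CoordIndex d) ℂ :=
  ∏ e : G.FaceEdges F, G.pairingPoly (G.black e) (A (G.white e)).rep -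
    ∏ e : G.FaceEdges F, G.pairingPoly (G.black e) (A (G.white (G.faceStep e))).rep
end

/-- The choices needed to write down equations of the space of compatible black data near a given
one. At each white vertex `w` of degree `m` one chooses an edge `drop w` and `m - 1` coordinates
(one for each other edge). Where the pivot minor is nonzero, the `m` hyperplanes at the neighbors
of `w` are dependent if and only if the `d + 2 - m` bordered minors vanish. One also omits
one of the faces. -/
structure EquationChoice (d : ℕ) where
  drop : ∀ w : G.White, G.WhiteStar w
  pivot : ∀ w : G.White, {e : G.WhiteStar w // e ≠ drop w} → Fin (d + 1)
  omitted : G.Face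

namespace EquationChoice

variable {G}

/-- The equations: for each white vertex, one for each coordinate which is not a pivot; and one for
each face but one. -/
abbrev Index (χ : G.EquationChoice d) : Type _ :=
  (Σ w : G.White, {j : Fin (d + 1) // j ∉ Set.range (χ.pivot w)}) ⊕ {F : G.Face // F ≠ χ.omitted}

/-- The circuit equations and the coherence equations. -/
def equation [Fintype E] (χ : G.EquationChoice d) (A : G.White → ProjPoint d) :
    χ.Index → MvPolynomial (G.CoordIndex d) ℂ
  | Sum.inl x => G.borderedMinor x.1 (χ.drop x.1) (χ.pivot x.1) x.2
  | Sum.inr F => G.coherencePoly A F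

/-- The choices are admissible at `l`: no pivot minor vanishes. -/
def AdmissibleAt [Fintype E] (χ : G.EquationChoice d) (l : G.HyperplaneAssignment d) : Prop :=
  ∀ w, MvPolynomial.eval (G.homogCoord l) (G.pivotMinor w (χ.drop w) (χ.pivot w)) ≠ 0

end EquationChoice

/-- The circuit and coherence equations on black data are independent at `l`: their
differentials (vectors of partial derivatives) at `l` are linearly independent. -/
def EquationsIndependentAt [Fintype E] (A : G.White → ProjPoint d)
    (l : G.HyperplaneAssignment d) : Prop :=
  ∃ χ : G.EquationChoice d, χ.AdmissibleAt l ∧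
    LinearIndependent ℂ fun (i : χ.Index) (v : G.CoordIndex d) =>
      MvPolynomial.eval (G.homogCoord l) (MvPolynomial.pderiv v (χ.equation A i))

/-- The equations on black data are independent: they are so at a generic point of the space of
compatible black data, that is, on a Zariski dense subset of it. -/
def EquationsIndependent [Fintype E] (A : G.White → ProjPoint d) : Prop :=
  G.compatibleBlackData A ⊆
    closure {l | l ∈ G.compatibleBlackData A ∧ G.EquationsIndependentAt A l}

end BipartiteSurfaceGraph

end

/-! The statement makes a parameter count rigorous: the dimension is the number of variables minus
the number of equations. In an affine chart of the product of dual projective spaces, keep all `(d +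
1)|B|` coordinates and treat the normalizations (one coordinate equal to `1` at each black vertex)
as `|B|` extra equations. A white vertex of degree `m` gives `d + 2 - m` circuit equations, so
together they give `(d + 2)|W| - |E|`, and coherence gives `|F| - 1`. With `|W| = |B|` the
difference is `1 - χ(Σ)`.

Upper bound: every irreducible component contains a nonempty open set, hence by density a point
where the differentials of the equations are independent. Euler's identity keeps them independent
after the normalizations are added. The Jacobian criterion
(`MvPolynomial.card_le_height_of_jacobian`) then bounds below the height of the prime ideal of the
component. A chain of irreducible closed subsets gives a chain of primes above that ideal, so its
length is at most the number of variables minus this height.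

Lower bound: Krull's height theorem at a point of the space gives a long chain of primes between the
ideal of the equations and the ideal of the point (`MvPolynomial.exists_ltSeries_of_eval_eq_zero`).
By the Nullstellensatz their zero loci stay distinct on a neighborhood of the point. There the
equations alone imply all conditions on black data: the bordered minors force dependence,
independence of proper subfamilies and nonvanishing pairings are open conditions, and the omitted
face is coherent because the product of all multi-ratios is `1`. -/

noncomputable section

/-! ### Heights of primes and chains of primes in polynomial rings. -/

section CommutativeAlgebra

/-- Linearly independent rows admit a nonvanishing maximal minor. -/
theorem LinearIndependent.exists_det_ne_zero {K ι σ : Type*} [Field K] [Fintype ι] [DecidableEq ι]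
    [Finite σ] {u : ι → σ → K} (hu : LinearIndependent K u) :
    ∃ v : ι → σ, (Matrix.of fun i j => u i (v j)).det ≠ 0 := by
  classical
  have := Fintype.ofFinite σ
  have hrank : (Matrix.of u).rank = Fintype.card ι := LinearIndependent.rank_matrix hu
  rw [Matrix.rank_eq_finrank_span_cols] at hrank
  -- Row rank equals column rank, so a basis of the column space picked among the columns has as
  -- many members as there are rows.
  obtain ⟨f, hf, -, hfi⟩ :=
    Submodule.exists_fun_fin_finrank_span_eq K (Set.range (Matrix.of u).col)
  choose v hv using hf
  let e := (Fintype.equivFin ι).trans (finCongr hrank.symm)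
  refine ⟨fun j => v (e j), ?_⟩
  have hcol : (Matrix.of fun i j => u i (v (e j))).col = f ∘ e := funext fun j => hv (e j)
  have hli : LinearIndependent K (Matrix.of fun i j => u i (v (e j))).col := by
    rw [hcol]
    exact hfi.comp e e.injective
  rw [Matrix.linearIndependent_cols_iff_isUnit, Matrix.isUnit_iff_isUnit_det] at hli
  exact hli.ne_zero

open MvPolynomial IsLocalRing

/-- By the Leibniz rule. This turns a relation modulo `I ^ 2`, as found in a cotangent space, into a
relation modulo `I` between derivatives. -/
theorem Derivation.apply_mem_of_mem_sq {R A : Type*} [CommRing R] [CommRing A] [Algebra R A]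
    (D : Derivation R A A) {I : Ideal A} {a : A} (ha : a ∈ I ^ 2) : D a ∈ I := by
  rw [pow_two] at ha
  refine Submodule.mul_induction_on ha (fun x hx y hy => ?_) (fun x y hx hy => ?_)
  · rw [D.leibniz]
    exact I.add_mem (I.mul_mem_right _ hx) (I.mul_mem_right _ hy)
  · rw [map_add]
    exact I.add_mem hx hy

/-- Jacobian criterion: a prime ideal which contains polynomials whose Jacobian matrix has a
maximal minor outside the ideal has height at least the number of these polynomials. -/
theorem MvPolynomial.card_le_height_of_jacobian {K ι σ : Type*} [Field K] [Fintype ι]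
    [DecidableEq ι] [Finite σ] (q : Ideal (MvPolynomial σ K)) [q.IsPrime]
    (f : ι → MvPolynomial σ K) (hf : ∀ i, f i ∈ q) (v : ι → σ)
    (hdet : (Matrix.of fun i j => pderiv (v j) (f i)).det ∉ q) :
    (Fintype.card ι : ℕ∞) ≤ q.height := by
  let S := Localization.AtPrime q
  -- In a regular local ring the dimension, here the height of `q`, is the dimension of the
  -- cotangent space. So it suffices that the classes of the `f i` are independent there.
  have hreg : IsRegularLocalRing S := inferInstance
  have hmem (i) : algebraMap (MvPolynomial σ K) S (f i) ∈ maximalIdeal S :=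
    (IsLocalization.AtPrime.to_map_mem_maximal_iff S q _).2 (hf i)
  have hli : LinearIndependent (ResidueField S)
      fun i => ((maximalIdeal S).toCotangent ⟨_, hmem i⟩ : CotangentSpace S) := by
    rw [Fintype.linearIndependent_iff]
    intro c hc
    choose a ha using fun i => residue_surjective (R := S) (c i)
    have hsum : ∑ i, a i * algebraMap (MvPolynomial σ K) S (f i) ∈ (maximalIdeal S) ^ 2 := by
      have h0 : (maximalIdeal S).toCotangent (∑ i, a i • ⟨_, hmem i⟩) = 0 := by
        rw [map_sum, ← hc]
        refine Finset.sum_congr rfl fun i _ => ?_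
        rw [← ha i, LinearMap.map_smul]
        exact (algebraMap_smul (ResidueField S) (a i) _).symm
      rw [Ideal.toCotangent_eq_zero] at h0
      simpa using h0
    -- Clear denominators: `b` is a common denominator of the coefficients `a i`, and a further `s ∉
    -- q` brings the relation into `q ^ 2` inside the polynomial ring itself.
    obtain ⟨b, hb⟩ := IsLocalization.exist_integer_multiples_of_finite q.primeCompl a
    choose r hr using hb
    have hsum' : algebraMap (MvPolynomial σ K) S (∑ i, r i * f i) ∈ (q ^ 2).map (algebraMap _ S) := by
      rw [Ideal.map_pow, Localization.AtPrime.map_eq_maximalIdeal]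
      have : algebraMap (MvPolynomial σ K) S (∑ i, r i * f i) =
          algebraMap _ S b.1 * ∑ i, a i * algebraMap (MvPolynomial σ K) S (f i) := by
        rw [map_sum, Finset.mul_sum]
        refine Finset.sum_congr rfl fun i _ => ?_
        rw [map_mul, hr, Algebra.smul_def, mul_assoc]
      rw [this]
      exact Ideal.mul_mem_left _ _ hsum
    rw [IsLocalization.mem_map_algebraMap_iff q.primeCompl] at hsum'
    obtain ⟨⟨⟨x, hx⟩, s⟩, hxs⟩ := hsum'
    rw [← map_mul] at hxs
    have hxs' := IsLocalization.injective S q.primeCompl_le_nonZeroDivisors hxs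
    simp only at hxs'
    have hD (w : σ) : ∑ i, (r i * s.1) * pderiv w (f i) ∈ q := by
      have h1 : pderiv w x ∈ q := (pderiv w).apply_mem_of_mem_sq hx
      rw [← hxs', Finset.sum_mul, map_sum] at h1
      have h2 : ∑ i, (r i * s.1) * pderiv w (f i) =
          ∑ i, pderiv w (r i * f i * s.1) - ∑ i, f i * pderiv w (r i * s.1) := by
        rw [← Finset.sum_sub_distrib]
        refine Finset.sum_congr rfl fun i _ => ?_
        rw [show r i * f i * s.1 = (r i * s.1) * f i by ring, Derivation.leibniz]
        simp only [smul_eq_mul]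
        ring
      rw [h2]
      exact q.sub_mem h1 (q.sum_mem fun i _ => q.mul_mem_right _ (hf i))
    -- Modulo `q` the coefficients form a left kernel vector of a square matrix with nonzero
    -- determinant over a domain.
    have hzero : (fun i => Ideal.Quotient.mk q (r i * s.1)) = 0 := by
      refine Matrix.eq_zero_of_vecMul_eq_zero
        (M := (Matrix.of fun i j => pderiv (v j) (f i)).map (Ideal.Quotient.mk q)) ?_ ?_
      · rw [← RingHom.mapMatrix_apply, ← RingHom.map_det]
        rwa [Ne, Ideal.Quotient.eq_zero_iff_mem]
      · funext j
        have := Ideal.Quotient.eq_zero_iff_mem.2 (hD (v j))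
        simpa [Matrix.vecMul, dotProduct] using this
    intro i
    have hri : r i * s.1 ∈ q := Ideal.Quotient.eq_zero_iff_mem.1 (congrFun hzero i)
    have hri' : r i ∈ q := (Ideal.IsPrime.mem_or_mem inferInstance hri).resolve_right s.2
    have h3 : algebraMap _ S (r i) ∈ maximalIdeal S :=
      (IsLocalization.AtPrime.to_map_mem_maximal_iff S q _).2 hri'
    rw [hr, Algebra.smul_def] at h3
    have h4 : a i ∈ maximalIdeal S := by
      refine (Ideal.IsPrime.mem_or_mem inferInstance h3).resolve_left fun h => b.2 ?_
      exact (IsLocalization.AtPrime.to_map_mem_maximal_iff S q _).1 h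
    rw [← ha i]
    exact (residue_eq_zero_iff _).2 h4
  have hfin := (IsRegularLocalRing.iff_finrank_cotangentSpace S).1 hreg
  rw [IsLocalization.AtPrime.ringKrullDim_eq_height q S] at hfin
  have hcard := hli.fintype_card_le_finrank
  have : ((Fintype.card ι : ℕ∞) : WithBot ℕ∞) ≤ q.height := by
    rw [← hfin]
    exact_mod_cast hcard
  exact_mod_cast this

/-- A chain of prime ideals starting at a prime ideal of height at least `m` has length at most the
number of variables minus `m`. -/
theorem MvPolynomial.length_add_height_le {K σ : Type*} [Field K] [Finite σ]
    (p : LTSeries (PrimeSpectrum (MvPolynomial σ K))) :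
    (p.length : ℕ∞) + p.head.asIdeal.height ≤ Nat.card σ := by
  have h1 : (p.length : ℕ∞) ≤ Order.coheight p.head := Order.length_le_coheight_head
  have h2 : ((⨆ a : PrimeSpectrum (MvPolynomial σ K), Order.height a + Order.coheight a : ℕ∞) :
      WithBot ℕ∞) = (Nat.card σ : ℕ∞) := by
    rw [← Order.krullDim_eq_iSup_height_add_coheight_of_nonempty]
    have := MvPolynomial.ringKrullDim_of_isNoetherianRing (R := K) (ι := σ)
    rw [ringKrullDim_eq_zero_of_field, zero_add] at this
    exact this
  rw [WithBot.coe_inj] at h2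
  rw [PrimeSpectrum.height_eq_orderHeight, ← h2, add_comm]
  exact (add_le_add_right h1 _).trans
    (le_iSup (fun a : PrimeSpectrum (MvPolynomial σ K) => Order.height a + Order.coheight a) p.head)

/-- At a common zero of finitely many polynomials there is a chain of prime ideals between the
ideal they generate and the ideal of the point, whose length is at least the number of variables
minus the number of polynomials. -/
theorem MvPolynomial.exists_ltSeries_of_eval_eq_zero {K ι σ : Type*} [Field K] [Fintype ι]
    [Finite σ] (f : ι → MvPolynomial σ K) (x : σ → K) (hf : ∀ i, eval x (f i) = 0) (n : ℕ)
    (hn : n + Fintype.card ι ≤ Nat.card σ) :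
    ∃ p : LTSeries (PrimeSpectrum (MvPolynomial σ K)), p.length = n ∧
      (∀ i, f i ∈ p.head.asIdeal) ∧ p.last.asIdeal ≤ RingHom.ker (eval x) := by
  classical
  have := Fintype.ofFinite σ
  have hprime : (RingHom.ker (eval x)).IsPrime := RingHom.ker_isPrime _
  -- The ideal of a point has full height: its generators `X v - C (x v)` have the identity as
  -- Jacobian matrix.
  have hN : (Nat.card σ : ℕ∞) ≤ (RingHom.ker (eval x)).height := by
    rw [Nat.card_eq_fintype_card]
    refine card_le_height_of_jacobian _ (fun v => X v - C (x v)) (fun v => ?_) id ?_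
    · simp [RingHom.mem_ker]
    · have : (Matrix.of fun i j : σ => pderiv (id j) (X i - C (x i) : MvPolynomial σ K)) = 1 := by
        ext1 i j
        by_cases h : i = j
        · subst h; simp
        · simp [pderiv_X, h]
      rw [this, Matrix.det_one]
      exact fun h => hprime.ne_top ((Ideal.eq_top_iff_one _).2 h)
  let I : Ideal (MvPolynomial σ K) := Ideal.span (Set.range f)
  have hsub : Set.range f ⊆ RingHom.ker (eval x) := by
    rintro _ ⟨i, rfl⟩
    exact hf i
  have hle : I ≤ RingHom.ker (eval x) := Ideal.span_le.2 hsub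
  -- Krull's height theorem: passing to the quotient by `I` lowers the height by at most the number
  -- of generators. The chain is built in the quotient and pulled back.
  have hheight := Ideal.height_le_height_add_encard_of_subset _ hsub
  have hcard : (Set.range f).encard ≤ Fintype.card ι := by
    rw [← Set.image_univ, ← ENat.card_eq_coe_fintype_card, ← Set.encard_univ]
    exact Set.encard_image_le f Set.univ
  have hker : RingHom.ker (Ideal.Quotient.mk I) ≤ RingHom.ker (eval x) := by
    rwa [Ideal.mk_ker]
  have hmap : ((RingHom.ker (eval x)).map (Ideal.Quotient.mk I)).IsPrime :=
    Ideal.map_isPrime_of_surjective Ideal.Quotient.mk_surjective hker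
  have hn' : (n : ℕ∞) ≤ Order.height (⟨_, hmap⟩ : PrimeSpectrum (MvPolynomial σ K ⧸ I)) := by
    rw [← PrimeSpectrum.height_eq_orderHeight]
    have h1 : (n : ℕ∞) + Fintype.card ι ≤
        ((RingHom.ker (eval x)).map (Ideal.Quotient.mk I)).height + Fintype.card ι := by
      refine le_trans ?_ (hN.trans (hheight.trans (by gcongr)))
      exact_mod_cast hn
    exact (ENat.add_le_add_iff_right (ENat.natCast_ne_top _)).1 h1
  obtain ⟨p, hlast, hlen⟩ := Order.exists_series_of_le_height _ hn'
  have hmono : StrictMono (PrimeSpectrum.comap (Ideal.Quotient.mk I)) :=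
    Monotone.strictMono_of_injective (fun a b hab => Ideal.comap_mono hab)
      (PrimeSpectrum.comap_injective_of_surjective _ Ideal.Quotient.mk_surjective)
  refine ⟨p.map _ hmono, hlen, fun i => ?_, ?_⟩
  · have : Ideal.Quotient.mk I (f i) = 0 :=
      Ideal.Quotient.eq_zero_iff_mem.2 (Ideal.subset_span ⟨i, rfl⟩)
    rw [LTSeries.head_map, PrimeSpectrum.comap_asIdeal, Ideal.mem_comap, this]
    exact Ideal.zero_mem _
  · rw [LTSeries.last_map, hlast, PrimeSpectrum.comap_asIdeal]
    rw [Ideal.comap_map_of_surjective _ Ideal.Quotient.mk_surjective]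
    exact sup_le le_rfl hker

end CommutativeAlgebra

end

noncomputable section

namespace BipartiteSurfaceGraph

variable {E : Type*} (G : BipartiteSurfaceGraph E) {d : ℕ}

instance [Finite E] : Finite G.White := Quotient.finite _

instance [Finite E] : Finite G.Black := Quotient.finite _

instance [Finite E] : Finite G.Face := Quotient.finite _

instance [Finite E] : Fintype G.White := Fintype.ofFinite _

instance [Finite E] : Fintype G.Black := Fintype.ofFinite _

instance [Finite E] : Fintype G.Face := Fintype.ofFinite _

/-! ### Multihomogeneous polynomials. -/

section Multihomogeneous

open MvPolynomial

variable {G}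

theorem IsMultihomogeneous.mul {P Q : MvPolynomial (G.CoordIndex d) ℂ} {m n : G.Black → ℕ}
    (hP : G.IsMultihomogeneous P m) (hQ : G.IsMultihomogeneous Q n) :
    G.IsMultihomogeneous (P * Q) (m + n) :=
  IsWeightedHomogeneous.mul hP hQ

theorem IsMultihomogeneous.add {P Q : MvPolynomial (G.CoordIndex d) ℂ} {n : G.Black → ℕ}
    (hP : G.IsMultihomogeneous P n) (hQ : G.IsMultihomogeneous Q n) :
    G.IsMultihomogeneous (P + Q) n :=
  IsWeightedHomogeneous.add hP hQ

theorem IsMultihomogeneous.sub {P Q : MvPolynomial (G.CoordIndex d) ℂ} {n : G.Black → ℕ}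
    (hP : G.IsMultihomogeneous P n) (hQ : G.IsMultihomogeneous Q n) :
    G.IsMultihomogeneous (P - Q) n := by
  classical
  exact Submodule.sub_mem (weightedHomogeneousSubmodule ℂ _ n) hP hQ

theorem isMultihomogeneous_C (a : ℂ) :
    G.IsMultihomogeneous (C a : MvPolynomial (G.CoordIndex d) ℂ) 0 :=
  isWeightedHomogeneous_C _ _

open Classical in
theorem isMultihomogeneous_X (v : G.CoordIndex d) :
    G.IsMultihomogeneous (X v) (Pi.single v.1 1) := by
  unfold IsMultihomogeneous
  convert isWeightedHomogeneous_X ℂ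
    (fun v : G.CoordIndex d => (Pi.single v.1 1 : G.Black → ℕ)) v

theorem IsMultihomogeneous.sum {ι : Type*} (s : Finset ι)
    {P : ι → MvPolynomial (G.CoordIndex d) ℂ} {n : G.Black → ℕ}
    (hP : ∀ i ∈ s, G.IsMultihomogeneous (P i) n) : G.IsMultihomogeneous (∑ i ∈ s, P i) n :=
  IsWeightedHomogeneous.sum s P n hP

theorem IsMultihomogeneous.prod {ι : Type*} (s : Finset ι)
    {P : ι → MvPolynomial (G.CoordIndex d) ℂ} {n : ι → G.Black → ℕ}
    (hP : ∀ i ∈ s, G.IsMultihomogeneous (P i) (n i)) :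
    G.IsMultihomogeneous (∏ i ∈ s, P i) (∑ i ∈ s, n i) :=
  IsWeightedHomogeneous.prod s P n hP

open Classical in
/-- A multihomogeneous polynomial scales by a monomial in the scaling factors of the blocks. -/
theorem IsMultihomogeneous.eval_scale [Finite E] {P : MvPolynomial (G.CoordIndex d) ℂ}
    {n : G.Black → ℕ} (hP : G.IsMultihomogeneous P n) (t : G.Black → ℂ) (x : G.CoordIndex d → ℂ) :
    eval (fun v => t v.1 * x v) P = (∏ b, t b ^ n b) * eval x P := by
  rw [eval_eq', eval_eq', Finset.mul_sum]
  refine Finset.sum_congr rfl fun m hm => ?_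
  have hw := hP (mem_support_iff.1 hm)
  have ht : ∏ v : G.CoordIndex d, t v.1 ^ m v = ∏ b, t b ^ n b := by
    rw [← Finset.prod_fiberwise_of_maps_to (g := Prod.fst) (t := Finset.univ)
      (fun _ _ => Finset.mem_univ _)]
    refine Finset.prod_congr rfl fun b _ => ?_
    rw [← hw, Finsupp.weight_apply, Finsupp.sum_fintype _ _ (by simp), Finset.sum_apply,
      Finset.prod_congr rfl (g := fun v => t b ^ m v), Finset.prod_pow_eq_pow_sum]
    · congr 1
      rw [Finset.sum_filter]
      refine Finset.sum_congr rfl fun v _ => ?_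
      by_cases h : v.1 = b
      · subst h; simp
      · simp [h, Ne.symm h]
    · intro v hv
      rw [(Finset.mem_filter.1 hv).2]
  simp only [mul_pow, Finset.prod_mul_distrib, ht]
  ring

end Multihomogeneous

/-! ### Affine charts and the Zariski topology. -/

section Chart

open MvPolynomial

/-- The assignments of hyperplanes at which the coordinates `c` do not vanish. -/
def chart (c : G.Black → Fin (d + 1)) : Set (G.HyperplaneAssignment d) :=
  {l | ∀ b, G.homogCoord l (b, c b) ≠ 0}

/-- Affine coordinates: at each black vertex `b` the coordinate `c b` is normalized to `1`. -/
def chartCoord (c : G.Black → Fin (d + 1)) (l : G.HyperplaneAssignment d)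
    (v : G.CoordIndex d) : ℂ :=
  G.homogCoord l v / G.homogCoord l (v.1, c v.1)

variable {G}

theorem chartCoord_self {c : G.Black → Fin (d + 1)} {l : G.HyperplaneAssignment d}
    (hl : l ∈ G.chart c) (b : G.Black) : G.chartCoord c l (b, c b) = 1 :=
  div_self (hl b)

theorem homogCoord_eq_mul_chartCoord {c : G.Black → Fin (d + 1)} {l : G.HyperplaneAssignment d}
    (hl : l ∈ G.chart c) :
    G.homogCoord l = fun v => G.homogCoord l (v.1, c v.1) * G.chartCoord c l v := by
  funext v
  rw [chartCoord, mul_div_cancel₀ _ (hl v.1)]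

variable (G) in
theorem exists_mem_chart (l : G.HyperplaneAssignment d) :
    ∃ c : G.Black → Fin (d + 1), l ∈ G.chart c := by
  have (b : G.Black) : ∃ i, G.homogCoord l (b, i) ≠ 0 := by
    by_contra! h
    refine (l b).rep_nonzero (LinearMap.pi_ext' fun i => LinearMap.ext_ring ?_)
    simpa [homogCoord] using h i
  choose c hc using this
  exact ⟨c, hc⟩

/-- The chart is onto the slice cut out by the normalizations, so a zero supplied by the
Nullstellensatz comes from an assignment of hyperplanes. -/
theorem exists_chartCoord_eq {c : G.Black → Fin (d + 1)} {x : G.CoordIndex d → ℂ}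
    (hx : ∀ b, x (b, c b) = 1) : ∃ l ∈ G.chart c, G.chartCoord c l = x := by
  let φ (b : G.Black) : Module.Dual ℂ (Fin (d + 1) → ℂ) :=
    Fintype.linearCombination ℂ fun i => x (b, i)
  have hφ (b : G.Black) (i : Fin (d + 1)) : φ b (Pi.single i 1) = x (b, i) := by
    simp [φ, Fintype.linearCombination_apply_single]
  have hφ0 (b : G.Black) : φ b ≠ 0 := fun h => by
    have := hφ b (c b)
    rw [h, hx] at this
    exact zero_ne_one this
  let l : G.HyperplaneAssignment d := fun b => Projectivization.mk ℂ (φ b) (hφ0 b)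
  have hl (v : G.CoordIndex d) : ∃ a : ℂˣ, ∀ i, G.homogCoord l (v.1, i) = a * x (v.1, i) := by
    obtain ⟨a, ha⟩ := Projectivization.exists_smul_eq_mk_rep ℂ (φ v.1) (hφ0 v.1)
    refine ⟨a, fun i => ?_⟩
    rw [← hφ]
    change (Projectivization.mk ℂ (φ v.1) (hφ0 v.1)).rep (Pi.single i 1) = _
    rw [← ha]
    rfl
  refine ⟨l, fun b => ?_, funext fun v => ?_⟩
  · obtain ⟨a, ha⟩ := hl (b, c b)
    rw [ha, hx, mul_one]
    exact a.ne_zero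
  · obtain ⟨a, ha⟩ := hl v
    rw [chartCoord, show G.homogCoord l v = a * x v from ha v.2, ha, hx, mul_one,
      mul_div_cancel_left₀ _ a.ne_zero]

theorem IsMultihomogeneous.eval_homogCoord [Finite E] {P : MvPolynomial (G.CoordIndex d) ℂ}
    {n : G.Black → ℕ} (hP : G.IsMultihomogeneous P n) {c : G.Black → Fin (d + 1)}
    {l : G.HyperplaneAssignment d} (hl : l ∈ G.chart c) :
    eval (G.homogCoord l) P = (∏ b, G.homogCoord l (b, c b) ^ n b) * eval (G.chartCoord c l) P := by
  conv_lhs => rw [homogCoord_eq_mul_chartCoord hl]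
  exact hP.eval_scale (fun b => G.homogCoord l (b, c b)) _

theorem prod_homogCoord_pow_ne_zero [Finite E] {c : G.Black → Fin (d + 1)}
    {l : G.HyperplaneAssignment d} (hl : l ∈ G.chart c) (n : G.Black → ℕ) :
    ∏ b, G.homogCoord l (b, c b) ^ n b ≠ 0 :=
  Finset.prod_ne_zero_iff.2 fun b _ => pow_ne_zero _ (hl b)

theorem IsMultihomogeneous.eval_chartCoord_eq_zero_iff [Finite E]
    {P : MvPolynomial (G.CoordIndex d) ℂ}
    {n : G.Black → ℕ} (hP : G.IsMultihomogeneous P n) {c : G.Black → Fin (d + 1)}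
    {l : G.HyperplaneAssignment d} (hl : l ∈ G.chart c) :
    eval (G.chartCoord c l) P = 0 ↔ eval (G.homogCoord l) P = 0 := by
  rw [hP.eval_homogCoord hl, mul_eq_zero, or_iff_right (prod_homogCoord_pow_ne_zero hl n)]

open Classical in
/-- Every polynomial in affine coordinates can be homogenized. -/
theorem exists_homogenization [Finite E] (c : G.Black → Fin (d + 1))
    (P : MvPolynomial (G.CoordIndex d) ℂ) :
    ∃ (Q : MvPolynomial (G.CoordIndex d) ℂ) (n : G.Black → ℕ), G.IsMultihomogeneous Q n ∧
      ∀ l ∈ G.chart c, eval (G.homogCoord l) Q =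
        (∏ b, G.homogCoord l (b, c b) ^ n b) * eval (G.chartCoord c l) P := by
  have hmon (n : G.Black → ℕ) : G.IsMultihomogeneous
      (∏ b, X (b, c b) ^ n b : MvPolynomial (G.CoordIndex d) ℂ) n := by
    have := IsMultihomogeneous.prod (G := G) (d := d) Finset.univ
      (P := fun b => X (b, c b) ^ n b) (n := fun b => n b • Pi.single b 1)
      fun b _ => IsWeightedHomogeneous.pow (isMultihomogeneous_X (b, c b)) _
    convert this using 1
    ext b
    simp [Finset.sum_apply, Pi.single_apply]
  induction P using MvPolynomial.induction_on with
  | C a => exact ⟨C a, 0, isMultihomogeneous_C a, by simp⟩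
  | add P P' hP hP' =>
    obtain ⟨Q, n, hQ, h⟩ := hP
    obtain ⟨Q', n', hQ', h'⟩ := hP'
    -- The two summands are brought to a common multidegree by monomials in the coordinates that the
    -- chart normalizes to `1`.
    refine ⟨Q * (∏ b, X (b, c b) ^ n' b) + (∏ b, X (b, c b) ^ n b) * Q', n + n',
      (hQ.mul (hmon n')).add ((hmon n).mul hQ'), fun l hl => ?_⟩
    simp only [map_add, map_mul, map_prod, map_pow, eval_X, h l hl, h' l hl, Pi.add_apply, pow_add,
      Finset.prod_mul_distrib]
    ring
  | mul_X P v hP =>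
    obtain ⟨Q, n, hQ, h⟩ := hP
    refine ⟨Q * X v, n + Pi.single v.1 1, hQ.mul (isMultihomogeneous_X v), fun l hl => ?_⟩
    have : ∏ b, G.homogCoord l (b, c b) ^ (Pi.single v.1 1 : G.Black → ℕ) b =
        G.homogCoord l (v.1, c v.1) := by
      rw [Finset.prod_eq_single v.1]
      · simp
      · intro b _ hb
        simp [hb]
      · simp
    simp only [map_mul, eval_X, h l hl, Pi.add_apply, pow_add, Finset.prod_mul_distrib, this]
    conv_lhs => rw [congrFun (homogCoord_eq_mul_chartCoord hl) v]
    ring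

theorem isOpen_setOf_eval_ne_zero {P : MvPolynomial (G.CoordIndex d) ℂ}
    {n : G.Black → ℕ} (hP : G.IsMultihomogeneous P n) :
    IsOpen {l : G.HyperplaneAssignment d | eval (G.homogCoord l) P ≠ 0} :=
  TopologicalSpace.isOpen_generateFrom_of_mem ⟨P, n, hP, rfl⟩

open Classical in
theorem isOpen_chart [Finite E] (c : G.Black → Fin (d + 1)) : IsOpen (G.chart c) := by
  have hQ := IsMultihomogeneous.prod Finset.univ fun b _ => isMultihomogeneous_X (G := G) (b, c b)
  convert isOpen_setOf_eval_ne_zero hQ using 1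
  ext l
  simp [chart, Finset.prod_eq_zero_iff]

/-- Nonvanishing loci of polynomials in affine coordinates are open. -/
theorem isOpen_chart_inter [Finite E] (c : G.Black → Fin (d + 1))
    (P : MvPolynomial (G.CoordIndex d) ℂ) :
    IsOpen {l | l ∈ G.chart c ∧ eval (G.chartCoord c l) P ≠ 0} := by
  obtain ⟨Q, n, hQ, h⟩ := exists_homogenization c P
  convert (isOpen_chart c).inter (isOpen_setOf_eval_ne_zero hQ) using 1
  ext l
  refine and_congr_right fun hl => ?_
  change _ ↔ eval (G.homogCoord l) Q ≠ 0
  rw [h l hl, Ne, Ne, mul_eq_zero, or_iff_right (prod_homogCoord_pow_ne_zero hl n)]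

variable (G d) in
theorem isTopologicalBasis : TopologicalSpace.IsTopologicalBasis
    {U : Set (G.HyperplaneAssignment d) |
      ∃ (P : MvPolynomial (G.CoordIndex d) ℂ) (n : G.Black → ℕ), G.IsMultihomogeneous P n ∧
        U = {l | eval (G.homogCoord l) P ≠ 0}} where
  exists_subset_inter := by
    rintro _ ⟨P, m, hP, rfl⟩ _ ⟨Q, n, hQ, rfl⟩ l ⟨hlP, hlQ⟩
    refine ⟨_, ⟨P * Q, m + n, hP.mul hQ, rfl⟩, ?_, fun l' hl' => ?_⟩
    · simpa using And.intro hlP hlQ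
    · simpa [not_or] using hl'
  sUnion_eq := Set.eq_univ_of_forall fun l => ⟨_, ⟨C 1, 0, isMultihomogeneous_C 1, rfl⟩, by simp⟩
  eq_generateFrom := rfl

theorem exists_multihomogeneous_of_isOpen {O : Set (G.HyperplaneAssignment d)} (hO : IsOpen O)
    {l : G.HyperplaneAssignment d} (hl : l ∈ O) :
    ∃ (P : MvPolynomial (G.CoordIndex d) ℂ) (n : G.Black → ℕ), G.IsMultihomogeneous P n ∧
      eval (G.homogCoord l) P ≠ 0 ∧ ∀ l', eval (G.homogCoord l') P ≠ 0 → l' ∈ O := by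
  obtain ⟨_, ⟨P, n, hP, rfl⟩, hlP, hsub⟩ := (G.isTopologicalBasis d).exists_subset_of_mem_open hl hO
  exact ⟨P, n, hP, hlP, fun l' hl' => hsub hl'⟩

/-- Sending an open set to the ideal of its complement is strictly monotone into the ideals of a
Noetherian ring. -/
instance [Finite E] : TopologicalSpace.NoetherianSpace (G.HyperplaneAssignment d) := by
  let I (U : TopologicalSpace.Opens (G.HyperplaneAssignment d)) :
      Ideal (MvPolynomial (G.CoordIndex d) ℂ) :=
    vanishingIdeal ℂ (G.homogCoord '' (U : Set (G.HyperplaneAssignment d))ᶜ)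
  have hI : StrictMono I := by
    intro U V hUV
    refine lt_of_le_of_ne (vanishingIdeal_anti_mono
      (Set.image_mono (Set.compl_subset_compl.2 hUV.le))) fun h => ?_
    obtain ⟨l, hlV, hlU⟩ := SetLike.exists_of_lt hUV
    obtain ⟨P, n, -, hlP, hP⟩ := exists_multihomogeneous_of_isOpen V.isOpen hlV
    have hPV : P ∈ I V := by
      rintro _ ⟨l', hl', rfl⟩
      by_contra h0
      exact hl' (hP l' (by simpa [aeval_eq_eval] using h0))
    rw [← h] at hPV
    exact hlP (by simpa [aeval_eq_eval] using hPV _ ⟨l, hlU, rfl⟩)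
  exact hI.wellFoundedGT

end Chart

end BipartiteSurfaceGraph

end

noncomputable section

/-! ### Linear dependence through minors. -/

section LinearAlgebra

/-- Rows with a nonvanishing maximal minor are linearly independent. -/
theorem Matrix.linearIndependent_of_det_ne_zero {K ι κ : Type*} [Field K] [Fintype ι]
    [DecidableEq ι] {r : ι → κ → K} (c : ι → κ) (h : (Matrix.of fun i j => r i (c j)).det ≠ 0) :
    LinearIndependent K r := by
  have := Matrix.linearIndependent_rows_of_det_ne_zero h
  exact LinearIndependent.of_comp (LinearMap.funLeft K K c) this

/-- If a pivot minor does not vanish, while all minors bordering it by the remaining row vanish, then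
the rows are linearly dependent. -/
theorem Matrix.not_linearIndependent_of_bordered {K ι κ : Type*} [Field K] [Fintype ι]
    [DecidableEq ι] (r : ι → κ → K) (i₀ : ι) (c : {i // i ≠ i₀} → κ)
    (hpivot : (Matrix.of fun i j : {i // i ≠ i₀} => r i (c j)).det ≠ 0)
    (hborder : ∀ j ∉ Set.range c,
      (Matrix.of fun i k => r i (if h : k = i₀ then j else c ⟨k, h⟩)).det = 0) :
    ¬LinearIndependent K r := by
  intro hr
  let M (j : κ) : Matrix ι ι K := Matrix.of fun i k => r i (if h : k = i₀ then j else c ⟨k, h⟩)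
  have hM (j : κ) : (M j).det = 0 := by
    by_cases hj : j ∈ Set.range c
    · obtain ⟨k, rfl⟩ := hj
      refine Matrix.det_zero_of_column_eq k.2 fun i => ?_
      simp [M, k.2]
    · exact hborder j hj
  by_cases hκ : Nonempty κ
  · obtain ⟨j₀⟩ := hκ
    have hupdate (j : κ) : M j = (M j₀).updateCol i₀ fun i => r i j := by
      ext i k
      by_cases h : k = i₀
      · subst h; simp [M]
      · simp [M, h]
    -- Expand the bordered minors along the column `i₀`: the cofactors do not depend on `j`, so they
    -- are the coefficients of a linear relation between the rows. The coefficient of `r i₀` is the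
    -- pivot minor.
    have hsum : ∑ i, (M j₀).adjugate i₀ i • r i = 0 := by
      funext j
      have := hM j
      rw [hupdate, ← Matrix.cramer_apply, Matrix.cramer_eq_adjugate_mulVec] at this
      simpa [Matrix.mulVec, dotProduct] using this
    have hadj := Fintype.linearIndependent_iff.1 hr _ hsum i₀
    rw [Matrix.adjugate_apply, Matrix.twoBlockTriangular_det _ (fun i => i ≠ i₀)] at hadj
    · refine mul_ne_zero ?_ ?_ hadj
      · convert hpivot using 2
        ext i j
        simp [Matrix.toSquareBlockProp, M, i.2, j.2]
      · have : ((M j₀).updateRow i₀ (Pi.single i₀ 1)).toSquareBlockProp (fun i => ¬i ≠ i₀) = 1 := by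
          ext ⟨i, hi⟩ ⟨j, hj⟩
          obtain rfl := not_not.1 hi
          obtain rfl := not_not.1 hj
          simp [Matrix.toSquareBlockProp]
        rw [this, Matrix.det_one]
        exact one_ne_zero
    · intro i hi j hj
      obtain rfl := not_not.1 hi
      simp [hj]
  · have := not_nonempty_iff.1 hκ
    exact hr.ne_zero i₀ (Subsingleton.elim _ _)

theorem linearIndependent_dual_iff {K ι κ : Type*} [Field K] [Finite κ] [DecidableEq κ]
    (f : ι → Module.Dual K (κ → K)) :
    LinearIndependent K f ↔ LinearIndependent K fun i k => f i (Pi.single k 1) := by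
  let L : Module.Dual K (κ → K) →ₗ[K] (κ → K) :=
    { toFun := fun φ k => φ (Pi.single k 1)
      map_add' := fun _ _ => rfl
      map_smul' := fun _ _ => rfl }
  have hL : LinearMap.ker L = ⊥ := LinearMap.ker_eq_bot'.2 fun φ hφ =>
    LinearMap.pi_ext' fun k => LinearMap.ext_ring (congrFun hφ k)
  exact (LinearMap.linearIndependent_iff L hL).symm

end LinearAlgebra

namespace BipartiteSurfaceGraph

variable {E : Type*} {G : BipartiteSurfaceGraph E} {d : ℕ}

open MvPolynomial

/-! ### Differentials of the equations: rescaling and normalization. -/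

section Derivatives

/-- Differentiate the scaling identity of `P`; the chain rule contributes the factor `t v.1` on the
left. -/
theorem IsMultihomogeneous.eval_pderiv_scale [Finite E] {P : MvPolynomial (G.CoordIndex d) ℂ}
    {n : G.Black → ℕ} (hP : G.IsMultihomogeneous P n) (t : G.Black → ℂ) (x : G.CoordIndex d → ℂ)
    (v : G.CoordIndex d) :
    t v.1 * eval (fun v => t v.1 * x v) (pderiv v P) =
      (∏ b, t b ^ n b) * eval x (pderiv v P) := by
  let S : MvPolynomial (G.CoordIndex d) ℂ →ₐ[ℂ] MvPolynomial (G.CoordIndex d) ℂ :=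
    aeval fun v => C (t v.1) * X v
  have hS (Q : MvPolynomial (G.CoordIndex d) ℂ) (y : G.CoordIndex d → ℂ) :
      eval y (S Q) = eval (fun v => t v.1 * y v) Q := by
    induction Q using MvPolynomial.induction_on with
    | C a => simp [S]
    | add P Q hP hQ => simp [hP, hQ]
    | mul_X P w hP => rw [map_mul, map_mul, map_mul, hP]; simp [S]
  have hSP : S P = C (∏ b, t b ^ n b) * P := MvPolynomial.funext fun y => by
    rw [hS, hP.eval_scale, map_mul, eval_C]
  have hD (Q : MvPolynomial (G.CoordIndex d) ℂ) : pderiv v (S Q) = C (t v.1) * S (pderiv v Q) := by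
    induction Q using MvPolynomial.induction_on with
    | C a => simp [S]
    | add P Q hP hQ => simp [hP, hQ, mul_add]
    | mul_X P w hP =>
      rw [map_mul, Derivation.leibniz, Derivation.leibniz, hP]
      by_cases h : w = v
      · subst h
        simp [S]
        ring
      · simp [S, h, Derivation.leibniz]
        ring
  have := congrArg (eval x) (hD P)
  rw [hSP, pderiv_C_mul, map_mul, map_mul, hS, eval_C, eval_C] at this
  exact this.symm

/-- Rescaling the representatives multiplies rows and columns of the Jacobian matrix by nonzero
factors, so independence can be moved from homogeneous coordinates to a chart and between charts. -/
theorem linearIndependent_pderiv_scale [Finite E] {ι : Type*}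
    {f : ι → MvPolynomial (G.CoordIndex d) ℂ} {n : ι → G.Black → ℕ}
    (hf : ∀ i, G.IsMultihomogeneous (f i) (n i)) {t : G.Black → ℂ} (ht : ∀ b, t b ≠ 0)
    {x : G.CoordIndex d → ℂ}
    (h : LinearIndependent ℂ fun (i : ι) (v : G.CoordIndex d) => eval x (pderiv v (f i))) :
    LinearIndependent ℂ fun (i : ι) (v : G.CoordIndex d) =>
      eval (fun v => t v.1 * x v) (pderiv v (f i)) := by
  let L : (G.CoordIndex d → ℂ) →ₗ[ℂ] (G.CoordIndex d → ℂ) :=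
    { toFun := fun w v => (t v.1)⁻¹ * w v
      map_add' := fun _ _ => funext fun _ => mul_add _ _ _
      map_smul' := fun _ _ => funext fun _ => mul_left_comm _ _ _ }
  have hL : LinearMap.ker L = ⊥ := LinearMap.ker_eq_bot'.2 fun w hw => funext fun v =>
    (mul_eq_zero.1 (congrFun hw v)).resolve_left (inv_ne_zero (ht v.1))
  have hT (i : ι) : ∏ b, t b ^ n i b ≠ 0 := Finset.prod_ne_zero_iff.2 fun b _ => pow_ne_zero _ (ht b)
  have key : (fun (i : ι) (v : G.CoordIndex d) => eval (fun v => t v.1 * x v) (pderiv v (f i))) =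
      (fun i => Units.mk0 _ (hT i)) •
        (L ∘ fun (i : ι) (v : G.CoordIndex d) => eval x (pderiv v (f i))) := by
    funext i v
    change _ = (∏ b, t b ^ n i b) * ((t v.1)⁻¹ * eval x (pderiv v (f i)))
    rw [mul_left_comm, ← (hf i).eval_pderiv_scale, inv_mul_cancel_left₀ (ht v.1)]
  rw [key]
  exact (h.map' L hL).units_smul _

open Classical in
/-- Euler's identity for one block of variables. -/
theorem IsMultihomogeneous.euler [Finite E] {P : MvPolynomial (G.CoordIndex d) ℂ}
    {n : G.Black → ℕ} (hP : G.IsMultihomogeneous P n) (b : G.Black) :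
    ∑ v : G.CoordIndex d, (if v.1 = b then X v * pderiv v P else 0) = n b • P := by
  have h : P.IsWeightedHomogeneous (fun v : G.CoordIndex d => if v.1 = b then 1 else 0) (n b) := by
    intro m hm
    rw [← hP hm, Finsupp.weight_apply, Finsupp.weight_apply, Finsupp.sum_fintype _ _ (by simp),
      Finsupp.sum_fintype _ _ (by simp), Finset.sum_apply]
    refine Finset.sum_congr rfl fun v _ => ?_
    by_cases h : v.1 = b
    · subst h; simp
    · simp [h, Ne.symm h]
  rw [← h.sum_weight_X_mul_pderiv]
  refine Finset.sum_congr rfl fun v _ => ?_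
  split_ifs <;> simp

/-- Independent multihomogeneous equations stay independent when the normalizations of an affine
chart are added. -/
theorem linearIndependent_pderiv_chart [Finite E] {ι : Type*} [Finite ι]
    {f : ι → MvPolynomial (G.CoordIndex d) ℂ} {n : ι → G.Black → ℕ}
    (hf : ∀ i, G.IsMultihomogeneous (f i) (n i)) {c : G.Black → Fin (d + 1)}
    {x : G.CoordIndex d → ℂ} (hx : ∀ b, x (b, c b) = 1) (hfx : ∀ i, eval x (f i) = 0)
    (h : LinearIndependent ℂ fun (i : ι) (v : G.CoordIndex d) => eval x (pderiv v (f i))) :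
    LinearIndependent ℂ fun (i : ι ⊕ G.Black) (v : G.CoordIndex d) =>
      eval x (pderiv v (Sum.elim f (fun b => X (b, c b) - 1) i)) := by
  classical
  have := Fintype.ofFinite ι
  rw [Fintype.linearIndependent_iff] at h ⊢
  intro g hg
  simp only [Fintype.sum_sum_type, Sum.elim_inl, Sum.elim_inr] at hg
  have hg' (v : G.CoordIndex d) : ∑ i, g (Sum.inl i) * eval x (pderiv v (f i)) +
      ∑ b, g (Sum.inr b) * (if (b, c b) = v then 1 else 0) = 0 := by
    have := congrFun hg v
    simp only [Pi.add_apply, Finset.sum_apply, Pi.smul_apply, smul_eq_mul, Pi.zero_apply, map_sub,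
      pderiv_X, Derivation.map_one_eq_zero, sub_zero] at this
    refine Eq.trans ?_ this
    congr 1
    refine Finset.sum_congr rfl fun b _ => ?_
    by_cases h : (b, c b) = v
    · subst h; simp
    · simp [h]
  have hb (b : G.Black) : g (Sum.inr b) = 0 := by
    -- Pair the relation with the block `b` of `x`. Euler's identity kills the differentials of the
    -- `f i`, which vanish at `x`, and among the normalizations only that of `b` survives.
    have h0 : ∑ v : G.CoordIndex d, (if v.1 = b then x v else 0) *
        (∑ i, g (Sum.inl i) * eval x (pderiv v (f i)) +
          ∑ b, g (Sum.inr b) * (if (b, c b) = v then 1 else 0)) = 0 :=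
      Finset.sum_eq_zero fun v _ => by rw [hg', mul_zero]
    simp only [mul_add, Finset.sum_add_distrib, Finset.mul_sum] at h0
    rw [Finset.sum_comm, Finset.sum_comm (γ := G.CoordIndex d)] at h0
    have h1 (i : ι) : ∑ v : G.CoordIndex d,
        (if v.1 = b then x v else 0) * (g (Sum.inl i) * eval x (pderiv v (f i))) = 0 := by
      have := congrArg (eval x) ((hf i).euler b)
      rw [map_sum, map_nsmul, hfx, smul_zero] at this
      refine Eq.trans ?_ ((congrArg (g (Sum.inl i) * ·) this).trans (mul_zero _))
      simp only [Finset.mul_sum]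
      refine Finset.sum_congr rfl fun v _ => ?_
      split_ifs
      · rw [map_mul, eval_X]
        ring
      · simp
    rw [Finset.sum_eq_zero fun i _ => h1 i, zero_add, Finset.sum_eq_single b] at h0
    · rw [Finset.sum_eq_single (b, c b)] at h0
      · simpa [hx] using h0
      · intro v _ hv
        simp [Ne.symm hv]
      · simp
    · intro b' _ hb'
      refine Finset.sum_eq_zero fun v _ => ?_
      by_cases h : (b', c b') = v
      · subst h; simp [hb']
      · simp [h]
    · simp
  rintro (i | b)
  · refine h (fun i => g (Sum.inl i)) (funext fun v => ?_) i
    simpa [hb] using hg' v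
  · exact hb b

end Derivatives

end BipartiteSurfaceGraph

end

noncomputable section

namespace BipartiteSurfaceGraph

variable {E : Type*} {G : BipartiteSurfaceGraph E} {d : ℕ}

open MvPolynomial

/-! ### The circuit and coherence equations, and what they imply locally. -/

section Equations

open Classical in
theorem isMultihomogeneous_det {ι : Type*} [Fintype ι] [DecidableEq ι] (β : ι → G.Black)
    (M : Matrix ι ι (MvPolynomial (G.CoordIndex d) ℂ))
    (hM : ∀ i j, G.IsMultihomogeneous (M i j) (Pi.single (β i) 1)) :
    G.IsMultihomogeneous M.det (∑ i, Pi.single (β i) 1) := by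
  rw [Matrix.det_apply']
  refine IsMultihomogeneous.sum _ fun σ _ => ?_
  rw [← map_intCast (C : ℂ →+* MvPolynomial (G.CoordIndex d) ℂ)]
  rw [← Equiv.sum_comp σ, ← zero_add (∑ i, _)]
  exact (isMultihomogeneous_C _).mul (IsMultihomogeneous.prod _ fun i _ => hM _ _)

open Classical in
theorem isMultihomogeneous_pivotMinor [Fintype E] (w : G.White) (e₀ : G.WhiteStar w)
    (c : {e : G.WhiteStar w // e ≠ e₀} → Fin (d + 1)) :
    ∃ n, G.IsMultihomogeneous (G.pivotMinor w e₀ c) n := by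
  rw [pivotMinor]
  refine ⟨_, isMultihomogeneous_det
    (fun e : {e : G.WhiteStar w // e ≠ e₀} => G.black e.1) _ fun e e' => ?_⟩
  exact isMultihomogeneous_X (G.black e.1, c e')

open Classical in
theorem isMultihomogeneous_borderedMinor [Fintype E] (w : G.White) (e₀ : G.WhiteStar w)
    (c : {e : G.WhiteStar w // e ≠ e₀} → Fin (d + 1)) (j : Fin (d + 1)) :
    ∃ n, G.IsMultihomogeneous (G.borderedMinor w e₀ c j) n := by
  rw [borderedMinor]
  refine ⟨_, isMultihomogeneous_det (fun e : G.WhiteStar w => G.black e) _ fun e e' => ?_⟩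
  exact isMultihomogeneous_X (G.black e, if h : e' = e₀ then j else c ⟨e', h⟩)

open Classical in
theorem isMultihomogeneous_pairingPoly (b : G.Black) (a : Fin (d + 1) → ℂ) :
    G.IsMultihomogeneous (G.pairingPoly b a) (Pi.single b 1) :=
  IsMultihomogeneous.sum _ fun i _ => IsWeightedHomogeneous.C_mul (isMultihomogeneous_X (b, i)) _

open Classical in
theorem isMultihomogeneous_coherencePoly [Fintype E] (A : G.White → ProjPoint d) (F : G.Face) :
    ∃ n, G.IsMultihomogeneous (G.coherencePoly A F) n :=
  ⟨_, (IsMultihomogeneous.prod _ fun _ _ => isMultihomogeneous_pairingPoly _ _).sub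
    (IsMultihomogeneous.prod _ fun _ _ => isMultihomogeneous_pairingPoly _ _)⟩

theorem EquationChoice.isMultihomogeneous_equation [Fintype E] (χ : G.EquationChoice d)
    (A : G.White → ProjPoint d) (i : χ.Index) :
    ∃ n, G.IsMultihomogeneous (χ.equation A i) n := by
  rcases i with x | F
  · exact isMultihomogeneous_borderedMinor _ _ _ _
  · exact isMultihomogeneous_coherencePoly _ _

open Classical in
theorem eval_pivotMinor [Fintype E] (x : G.CoordIndex d → ℂ) (w : G.White) (e₀ : G.WhiteStar w)
    (c : {e : G.WhiteStar w // e ≠ e₀} → Fin (d + 1)) :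
    eval x (G.pivotMinor w e₀ c) =
      (Matrix.of fun e e' : {e : G.WhiteStar w // e ≠ e₀} => x (G.black e.1, c e')).det := by
  rw [pivotMinor, RingHom.map_det]
  congr 1
  ext e e'
  simp

open Classical in
theorem eval_borderedMinor [Fintype E] (x : G.CoordIndex d → ℂ) (w : G.White) (e₀ : G.WhiteStar w)
    (c : {e : G.WhiteStar w // e ≠ e₀} → Fin (d + 1)) (j : Fin (d + 1)) :
    eval x (G.borderedMinor w e₀ c j) =
      (Matrix.of fun e e' : G.WhiteStar w =>
        x (G.black e, if h : e' = e₀ then j else c ⟨e', h⟩)).det := by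
  rw [borderedMinor, RingHom.map_det]
  congr 1
  ext e e'
  simp

theorem eval_pairingPoly (l : G.HyperplaneAssignment d) (b : G.Black) (a : Fin (d + 1) → ℂ) :
    eval (G.homogCoord l) (G.pairingPoly b a) = (l b).rep a := by
  rw [LinearMap.pi_apply_eq_sum_univ (l b).rep a, pairingPoly, map_sum]
  refine Finset.sum_congr rfl fun i _ => ?_
  rw [map_mul, eval_C, eval_X, homogCoord, smul_eq_mul]
  congr 2
  ext j
  simp [Pi.single_apply, eq_comm]

/-- The coordinates of the hyperplanes at the edges of a white vertex. -/
def starRows (l : G.HyperplaneAssignment d) (w : G.White) (e : G.WhiteStar w) (i : Fin (d + 1)) :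
    ℂ :=
  G.homogCoord l (G.black e, i)

theorem isDualCircuitConfiguration_iff (l : G.HyperplaneAssignment d) :
    G.IsDualCircuitConfiguration l ↔ ∀ w, ¬LinearIndependent ℂ (starRows l w) ∧
      ∀ s : Set (G.WhiteStar w), s ≠ Set.univ →
        LinearIndependent ℂ fun e : s => starRows l w e := by
  refine forall_congr' fun w => ?_
  rw [IsCircuit, Projectivization.dependent_iff, linearIndependent_dual_iff]
  refine and_congr Iff.rfl (forall_congr' fun s => imp_congr_right fun _ => ?_)
  rw [Projectivization.independent_iff, linearIndependent_dual_iff]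
  rfl

open Classical in
/-- The product of the values of the hyperplanes at the points at the beginnings of the edges of
a face. -/
def faceNum [Fintype E] (A : G.White → ProjPoint d) (l : G.HyperplaneAssignment d)
    (F : G.Face) : ℂ :=
  ∏ e : G.FaceEdges F, (l (G.black e)).rep (A (G.white e)).rep

open Classical in
/-- The product of the values of the hyperplanes at the points following them along a face. -/
def faceDen [Fintype E] (A : G.White → ProjPoint d) (l : G.HyperplaneAssignment d)
    (F : G.Face) : ℂ :=
  ∏ e : G.FaceEdges F, (l (G.black e)).rep (A (G.white (G.faceStep e))).rep

theorem multiRatio_eq_one_iff [Fintype E] (A : G.White → ProjPoint d)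
    (l : G.HyperplaneAssignment d) (F : G.Face) :
    G.multiRatio A l F = 1 ↔ faceDen A l F ≠ 0 ∧ faceNum A l F = faceDen A l F := by
  change faceNum A l F / faceDen A l F = 1 ↔ _
  by_cases h : faceDen A l F = 0
  · simp [h]
  · simp [h, div_eq_one_iff_eq h]

theorem eval_coherencePoly [Fintype E] (A : G.White → ProjPoint d)
    (l : G.HyperplaneAssignment d) (F : G.Face) :
    eval (G.homogCoord l) (G.coherencePoly A F) = faceNum A l F - faceDen A l F := by
  rw [coherencePoly, map_sub, map_prod, map_prod]
  simp only [eval_pairingPoly]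
  rfl

open Classical in
theorem prod_face [Fintype E] (g : E → ℂ) : ∏ F : G.Face, ∏ e : G.FaceEdges F, g e = ∏ e, g e :=
  Fintype.prod_fiberwise G.face g

/-- The edge `G.rotB⁻¹ e` joins the black endpoint of `e` to the next white vertex on the face, so
the denominator factors are again values at edges. -/
theorem rep_faceStep (A : G.White → ProjPoint d) (l : G.HyperplaneAssignment d) (e : E) :
    (l (G.black e)).rep (A (G.white (G.faceStep e))).rep =
      (l (G.black (G.rotB⁻¹ e))).rep (A (G.white (G.rotB⁻¹ e))).rep := by
  have hb : G.black (G.rotB⁻¹ e) = G.black e :=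
    Quotient.sound (s := Equiv.Perm.SameCycle.setoid G.rotB) ⟨1, by simp⟩
  have hw : G.white (G.faceStep e) = G.white (G.rotB⁻¹ e) :=
    Quotient.sound (s := Equiv.Perm.SameCycle.setoid G.rotW) ⟨1, by simp [faceStep]⟩
  rw [hb, hw]

/-- Each edge has one face on either side, so it occurs once in a numerator and once in a
denominator. -/
theorem prod_faceNum_eq_prod_faceDen [Fintype E] (A : G.White → ProjPoint d)
    (l : G.HyperplaneAssignment d) : ∏ F, faceNum A l F = ∏ F, faceDen A l F := by
  unfold faceNum faceDen
  rw [prod_face fun e => (l (G.black e)).rep (A (G.white e)).rep,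
    prod_face fun e => (l (G.black e)).rep (A (G.white (G.faceStep e))).rep]
  simp only [rep_faceStep]
  exact (Equiv.prod_comp (G.rotB⁻¹) fun e => (l (G.black e)).rep (A (G.white e)).rep).symm

/-- Coherence of one face follows from the coherence of the others. -/
theorem isCoherent_of_forall_ne [Fintype E] {A : G.White → ProjPoint d}
    {l : G.HyperplaneAssignment d}
    (hne : ∀ e, (l (G.black e)).rep (A (G.white e)).rep ≠ 0) (F₀ : G.Face)
    (h : ∀ F ≠ F₀, faceNum A l F = faceDen A l F) : G.IsCoherent A l := by
  classical
  have hden (F : G.Face) : faceDen A l F ≠ 0 := by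
    refine Finset.prod_ne_zero_iff.2 fun e _ => ?_
    rw [rep_faceStep]
    exact hne _
  intro F
  rw [multiRatio_eq_one_iff]
  refine ⟨hden F, ?_⟩
  by_cases hF : F = F₀
  · subst hF
    have := prod_faceNum_eq_prod_faceDen A l
    rw [← Finset.mul_prod_erase _ _ (Finset.mem_univ F),
      ← Finset.mul_prod_erase _ _ (Finset.mem_univ F),
      Finset.prod_congr rfl fun F' hF' => h F' (Finset.ne_of_mem_erase hF')] at this
    exact mul_right_cancel₀ (Finset.prod_ne_zero_iff.2 fun F' _ => hden F') this
  · exact h F hF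

theorem rep_ne_zero_of_isCoherent [Fintype E] {A : G.White → ProjPoint d}
    {l : G.HyperplaneAssignment d} (h : G.IsCoherent A l) (e : E) :
    (l (G.black e)).rep (A (G.white e)).rep ≠ 0 := by
  classical
  -- A ratio with vanishing denominator is `0` by convention, so the value `1` makes denominator and
  -- numerator nonzero.
  have h1 := (multiRatio_eq_one_iff A l (G.face e)).1 (h _)
  rw [← h1.2] at h1
  exact Finset.prod_ne_zero_iff.1 h1.1 ⟨e, rfl⟩ (Finset.mem_univ _)

/-- All the equations hold on the space of compatible black data. -/
theorem EquationChoice.eval_equation_eq_zero [Fintype E] (χ : G.EquationChoice d)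
    {A : G.White → ProjPoint d} {l : G.HyperplaneAssignment d} (hl : l ∈ G.compatibleBlackData A)
    (i : χ.Index) : eval (G.homogCoord l) (χ.equation A i) = 0 := by
  classical
  obtain ⟨-, hdual, hcoh⟩ := hl
  rcases i with ⟨w, j, hj⟩ | F
  · change eval _ (G.borderedMinor w (χ.drop w) (χ.pivot w) j) = 0
    rw [eval_borderedMinor, ← Matrix.exists_vecMul_eq_zero_iff]
    have h := ((isDualCircuitConfiguration_iff l).1 hdual w).1
    rw [Fintype.linearIndependent_iff] at h
    push Not at h
    obtain ⟨g, hg, e, he⟩ := h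
    refine ⟨g, fun h0 => he (congrFun h0 e), funext fun e' => ?_⟩
    have := congrFun hg (if h : e' = χ.drop w then j else χ.pivot w ⟨e', h⟩)
    simpa [Matrix.vecMul, dotProduct, starRows] using this
  · change eval _ (G.coherencePoly A F) = 0
    rw [eval_coherencePoly, sub_eq_zero]
    exact ((multiRatio_eq_one_iff A l F).1 (hcoh F)).2

/-- Near an admissible point the equations describe the space of compatible black data. -/
theorem EquationChoice.exists_mem_compatibleBlackData [Fintype E] (χ : G.EquationChoice d)
    {A : G.White → ProjPoint d} {p : G.HyperplaneAssignment d} (hp : p ∈ G.compatibleBlackData A)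
    (hχ : χ.AdmissibleAt p) :
    ∃ (Q : MvPolynomial (G.CoordIndex d) ℂ) (n : G.Black → ℕ), G.IsMultihomogeneous Q n ∧
      eval (G.homogCoord p) Q ≠ 0 ∧ ∀ l, eval (G.homogCoord l) Q ≠ 0 →
        (∀ i, eval (G.homogCoord l) (χ.equation A i) = 0) → l ∈ G.compatibleBlackData A := by
  classical
  obtain ⟨hA, hdual, hcoh⟩ := hp
  -- For every edge `e`, not only the dropped ones, some maximal minor of the other covectors at its
  -- white endpoint is nonzero. A proper subfamily omits some edge, so these minors control all
  -- proper subfamilies.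
  have hcol (e : E) : ∃ c : {e' : G.WhiteStar (G.white e) // e' ≠ ⟨e, rfl⟩} → Fin (d + 1),
      eval (G.homogCoord p) (G.pivotMinor (G.white e) ⟨e, rfl⟩ c) ≠ 0 := by
    have h := ((isDualCircuitConfiguration_iff p).1 hdual (G.white e)).2
      {e' | e' ≠ ⟨e, rfl⟩} (fun h => (h.symm ▸ Set.mem_univ (⟨e, rfl⟩ : G.WhiteStar (G.white e)) :
        (⟨e, rfl⟩ : G.WhiteStar (G.white e)) ∈ {e' | e' ≠ ⟨e, rfl⟩}) rfl)
    obtain ⟨c, hc⟩ := LinearIndependent.exists_det_ne_zero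
      (ι := {e' : G.WhiteStar (G.white e) // e' ≠ ⟨e, rfl⟩}) h
    refine ⟨c, ?_⟩
    rw [eval_pivotMinor]
    exact hc
  choose c hc using hcol
  choose n₁ hn₁ using fun w => isMultihomogeneous_pivotMinor w (χ.drop w) (χ.pivot w)
  choose n₂ hn₂ using fun e => isMultihomogeneous_pivotMinor (G.white e) ⟨e, rfl⟩ (c e)
  -- The three factors of `Q` keep the pivot minors nonzero, the proper subfamilies independent, and
  -- the pairings along edges nonzero.
  refine ⟨_, _, ((IsMultihomogeneous.prod Finset.univ fun w _ => hn₁ w).mul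
    (IsMultihomogeneous.prod Finset.univ fun e _ => hn₂ e)).mul
    (IsMultihomogeneous.prod Finset.univ fun e _ =>
      isMultihomogeneous_pairingPoly (G.black e) (A (G.white e)).rep), ?_, fun l hl heq => ?_⟩
  · simp only [map_mul, map_prod]
    refine mul_ne_zero (mul_ne_zero ?_ ?_) ?_
    · exact Finset.prod_ne_zero_iff.2 fun w _ => hχ w
    · exact Finset.prod_ne_zero_iff.2 fun e _ => hc e
    · refine Finset.prod_ne_zero_iff.2 fun e _ => ?_
      rw [eval_pairingPoly]
      exact rep_ne_zero_of_isCoherent hcoh e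
  · simp only [map_mul, map_prod, ne_eq, mul_eq_zero, not_or, Finset.prod_eq_zero_iff, not_exists,
      not_and, Finset.mem_univ, forall_const] at hl
    obtain ⟨⟨h₁, h₂⟩, h₃⟩ := hl
    refine ⟨hA, (isDualCircuitConfiguration_iff l).2 fun w => ⟨?_, fun s hs => ?_⟩,
      isCoherent_of_forall_ne (fun e => ?_) χ.omitted fun F hF => ?_⟩
    · refine Matrix.not_linearIndependent_of_bordered (starRows l w) (χ.drop w) (χ.pivot w) ?_
        fun j hj => ?_
      · have := h₁ w
        rw [eval_pivotMinor] at this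
        exact this
      · have := heq (Sum.inl ⟨w, j, hj⟩)
        change eval _ (G.borderedMinor w (χ.drop w) (χ.pivot w) j) = 0 at this
        rw [eval_borderedMinor] at this
        exact this
    · obtain ⟨⟨e, rfl⟩, he⟩ := (Set.ne_univ_iff_exists_notMem s).1 hs
      have h := h₂ e
      rw [eval_pivotMinor] at h
      have hli := Matrix.linearIndependent_of_det_ne_zero
        (r := fun e' : {e' : G.WhiteStar (G.white e) // e' ≠ ⟨e, rfl⟩} =>
          starRows l (G.white e) e') (c e) h
      exact hli.comp (fun e' : s => ⟨e', fun h => he (h ▸ e'.2)⟩)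
        fun a b hab => Subtype.ext (congrArg (fun x => x.1) hab)
    · rw [← eval_pairingPoly]
      exact h₃ e
    · have := heq (Sum.inr ⟨F, hF⟩)
      change eval _ (G.coherencePoly A F) = 0 at this
      rwa [eval_coherencePoly, sub_eq_zero] at this

end Equations

end BipartiteSurfaceGraph

end

noncomputable section

namespace BipartiteSurfaceGraph

variable {E : Type*} {G : BipartiteSurfaceGraph E} {d : ℕ}

open MvPolynomial

/-! ### From irreducible closed sets to prime ideals. -/

section VanishingIdeal

/-- The polynomials in affine coordinates which vanish on a set of assignments of hyperplanes. -/
def chartIdeal {S : Set (G.HyperplaneAssignment d)} (c : G.Black → Fin (d + 1)) (T : Set S) :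
    Ideal (MvPolynomial (G.CoordIndex d) ℂ) :=
  vanishingIdeal ℂ (G.chartCoord c '' {l | l ∈ G.chart c ∧ ∃ h : l ∈ S, ⟨l, h⟩ ∈ T})

theorem mem_chartIdeal_iff {S : Set (G.HyperplaneAssignment d)} {c : G.Black → Fin (d + 1)}
    {T : Set S} {P : MvPolynomial (G.CoordIndex d) ℂ} :
    P ∈ chartIdeal c T ↔ ∀ l ∈ T, l.1 ∈ G.chart c → eval (G.chartCoord c l.1) P = 0 := by
  constructor
  · intro h l hl hc
    simpa [aeval_eq_eval] using h _ ⟨l.1, ⟨hc, l.2, hl⟩, rfl⟩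
  · rintro h _ ⟨l, ⟨hc, hS, hl⟩, rfl⟩
    simpa [aeval_eq_eval] using h ⟨l, hS⟩ hl hc

theorem chartIdeal_anti {S : Set (G.HyperplaneAssignment d)} (c : G.Black → Fin (d + 1))
    {T T' : Set S} (h : T ⊆ T') : chartIdeal c T' ≤ chartIdeal c T := fun P hP => by
  rw [mem_chartIdeal_iff] at hP ⊢
  exact fun l hl => hP l (h hl)

theorem chartIdeal_isPrime [Finite E] {S : Set (G.HyperplaneAssignment d)}
    {c : G.Black → Fin (d + 1)} {T : Set S} (hT : IsPreirreducible T)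
    (hne : ∃ l ∈ T, l.1 ∈ G.chart c) : (chartIdeal c T).IsPrime where
  ne_top' h := by
    obtain ⟨l, hl, hc⟩ := hne
    have := mem_chartIdeal_iff.1 ((Ideal.eq_top_iff_one _).1 h) l hl hc
    simp at this
  mem_or_mem' {P Q} hPQ := by
    by_contra! h
    simp only [mem_chartIdeal_iff, not_forall] at h
    obtain ⟨⟨l, hl, hlc, hlP⟩, ⟨l', hl', hlc', hlQ⟩⟩ := h
    obtain ⟨m, hm, ⟨hmc, hmP⟩, ⟨-, hmQ⟩⟩ := hT _ _
      ((isOpen_chart_inter c P).preimage continuous_subtype_val)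
      ((isOpen_chart_inter c Q).preimage continuous_subtype_val) ⟨l, hl, hlc, hlP⟩
      ⟨l', hl', hlc', hlQ⟩
    have := mem_chartIdeal_iff.1 hPQ m hm hmc
    rw [map_mul, mul_eq_zero] at this
    exact this.elim hmP hmQ

/-- By irreducibility, `T'` has a point outside `T` inside the chart. A multihomogeneous polynomial
that vanishes on `T` but not at that point separates the ideals. -/
theorem chartIdeal_lt [Finite E] {S : Set (G.HyperplaneAssignment d)}
    {c : G.Black → Fin (d + 1)} {T T' : Set S} (hT : IsClosed T) (hT' : IsPreirreducible T')
    (hne : ∃ l ∈ T', l.1 ∈ G.chart c) (h : T ⊂ T') : chartIdeal c T' < chartIdeal c T := by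
  refine lt_of_le_of_ne (chartIdeal_anti c h.subset) fun heq => ?_
  obtain ⟨l, hlT', hlT⟩ := Set.exists_of_ssubset h
  obtain ⟨m, hmT', hmT, hmc⟩ := hT' _ _ hT.isOpen_compl
    ((isOpen_chart c).preimage continuous_subtype_val) ⟨l, hlT', hlT⟩ hne
  obtain ⟨O, hO, hOT⟩ := hT.isOpen_compl
  rw [← hOT] at hmT
  obtain ⟨P, n, hP, hmP, hPO⟩ := exists_multihomogeneous_of_isOpen hO hmT
  have hPT : P ∈ chartIdeal c T := mem_chartIdeal_iff.2 fun l' hl' hlc' => by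
    rw [hP.eval_chartCoord_eq_zero_iff hlc']
    by_contra h0
    have : l' ∈ Subtype.val ⁻¹' O := hPO _ h0
    rw [hOT] at this
    exact this hl'
  rw [← heq] at hPT
  exact hmP ((hP.eval_chartCoord_eq_zero_iff hmc).1 (mem_chartIdeal_iff.1 hPT m hmT' hmc))

end VanishingIdeal

/-! ### The dimension is at most the expected one. -/

section UpperBound

theorem linearIndependent_pderiv_chartCoord [Finite E] {ι : Type*}
    {f : ι → MvPolynomial (G.CoordIndex d) ℂ} {n : ι → G.Black → ℕ}
    (hf : ∀ i, G.IsMultihomogeneous (f i) (n i)) {c : G.Black → Fin (d + 1)}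
    {l : G.HyperplaneAssignment d} (hl : l ∈ G.chart c)
    (h : LinearIndependent ℂ fun (i : ι) (v : G.CoordIndex d) =>
      eval (G.homogCoord l) (pderiv v (f i))) :
    LinearIndependent ℂ fun (i : ι) (v : G.CoordIndex d) =>
      eval (G.chartCoord c l) (pderiv v (f i)) := by
  rw [homogCoord_eq_mul_chartCoord hl] at h
  have h' := linearIndependent_pderiv_scale hf
    (t := fun b => (G.homogCoord l (b, c b))⁻¹) (fun b => inv_ne_zero (hl b)) h
  simpa only [inv_mul_cancel_left₀ (hl _)] using h'

theorem chartCoord_eq_mul_chartCoord {c c' : G.Black → Fin (d + 1)} {l : G.HyperplaneAssignment d}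
    (hl : l ∈ G.chart c) : G.chartCoord c' l = fun v =>
      (G.homogCoord l (v.1, c v.1) / G.homogCoord l (v.1, c' v.1)) * G.chartCoord c l v := by
  funext v
  have := hl v.1
  simp only [chartCoord]
  field_simp

theorem topologicalKrullDim_le [Fintype E] {A : G.White → ProjPoint d}
    (hind : G.EquationsIndependent A) {n : ℕ}
    (hn : ∀ (χ : G.EquationChoice d) (l : G.HyperplaneAssignment d), χ.AdmissibleAt l →
      Nat.card (G.CoordIndex d) ≤ n + (Nat.card χ.Index + Nat.card G.Black)) :
    topologicalKrullDim (G.compatibleBlackData A) ≤ n := by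
  classical
  refine iSup_le fun p => ?_
  -- The largest set of the chain lies in a component `Y`, which contains a nonempty open set and
  -- hence a point `l₁` with independent equations.
  obtain ⟨Y, hY, hlast⟩ := exists_mem_irreducibleComponents_subset_of_isIrreducible
    (p.last : Set (G.compatibleBlackData A)) p.last.isIrreducible'
  obtain ⟨_, ⟨O, hO, rfl⟩, ⟨y, hyO⟩, hOY⟩ :=
    TopologicalSpace.NoetherianSpace.exists_isOpen_nonempty_subset_irreducibleComponent Y hY
  obtain ⟨l₁, hl₁O, hl₁, χ, hχ, hli₁⟩ := mem_closure_iff.1 (hind y.2) O hO hyO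
  have hl₁Y : ⟨l₁, hl₁⟩ ∈ Y := hOY hl₁O
  choose k hk using χ.isMultihomogeneous_equation A
  have : Fintype χ.Index := Fintype.ofFinite _
  obtain ⟨c₁, hc₁⟩ := G.exists_mem_chart l₁
  obtain ⟨v₁, hv₁⟩ := (linearIndependent_pderiv_chartCoord hk hc₁ hli₁).exists_det_ne_zero
  let M : MvPolynomial (G.CoordIndex d) ℂ :=
    (Matrix.of fun i j => pderiv (v₁ j) (χ.equation A i)).det
  have hM (x : G.CoordIndex d → ℂ) : eval x M =
      (Matrix.of fun i j => eval x (pderiv (v₁ j) (χ.equation A i))).det := by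
    rw [RingHom.map_det]
    rfl
  -- A chart meeting the smallest set of the chain meets all of them, but may miss `l₁`.
  -- Independence is an open condition, given by the minor `M`, so irreducibility of `Y` provides a
  -- point `l₂` in this chart where it also holds.
  obtain ⟨l₀, hl₀⟩ := p.head.isIrreducible'.nonempty
  obtain ⟨c, hc⟩ := G.exists_mem_chart l₀.1
  have hhead (i : Fin (p.length + 1)) : ∃ l ∈ (p i : Set (G.compatibleBlackData A)),
      l.1 ∈ G.chart c := ⟨l₀, (LTSeries.head_le p i : _ ≤ _) hl₀, hc⟩
  obtain ⟨l₂, hl₂Y, hc₂, ⟨hc₁₂, hM₂⟩⟩ := hY.1.isPreirreducible _ _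
    ((isOpen_chart c).preimage continuous_subtype_val)
    ((isOpen_chart_inter c₁ M).preimage continuous_subtype_val)
    ⟨l₀, hlast ((LTSeries.head_le_last p : _ ≤ _) hl₀), hc⟩
    ⟨⟨l₁, hl₁⟩, hl₁Y, hc₁, by rw [hM]; exact hv₁⟩
  rw [hM] at hM₂
  have hli₂ := Matrix.linearIndependent_of_det_ne_zero
    (r := fun i v => eval (G.chartCoord c₁ l₂.1) (pderiv v (χ.equation A i))) v₁ hM₂
  have hli₂' := linearIndependent_pderiv_scale hk
    (t := fun b => G.homogCoord l₂.1 (b, c₁ b) / G.homogCoord l₂.1 (b, c b))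
    (fun b => div_ne_zero (hc₁₂ b) (hc₂ b)) hli₂
  rw [← chartCoord_eq_mul_chartCoord hc₁₂] at hli₂'
  have heq (l : G.compatibleBlackData A) (hl : l.1 ∈ G.chart c) (i : χ.Index) :
      eval (G.chartCoord c l.1) (χ.equation A i) = 0 :=
    ((hk i).eval_chartCoord_eq_zero_iff hl).2 (χ.eval_equation_eq_zero l.2 i)
  have hli₃ := linearIndependent_pderiv_chart hk (chartCoord_self hc₂) (heq l₂ hc₂) hli₂'
  obtain ⟨v₂, hv₂⟩ := hli₃.exists_det_ne_zero
  have hYprime : (chartIdeal c Y).IsPrime :=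
    chartIdeal_isPrime hY.1.isPreirreducible ⟨l₂, hl₂Y, hc₂⟩
  have hheight := card_le_height_of_jacobian (chartIdeal c Y)
    (Sum.elim (χ.equation A) fun b => X (b, c b) - 1) (fun i => mem_chartIdeal_iff.2 fun l _ hl => by
      rcases i with i | b
      · exact heq l hl i
      · simp [chartCoord_self hl]) v₂ (fun h => by
      have := mem_chartIdeal_iff.1 h l₂ hl₂Y hc₂
      rw [RingHom.map_det] at this
      exact hv₂ this)
  -- Vanishing ideals reverse inclusions, hence the reversed index.
  let J (i : Fin (p.length + 1)) : PrimeSpectrum (MvPolynomial (G.CoordIndex d) ℂ) :=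
    ⟨chartIdeal c (p i.rev : Set (G.compatibleBlackData A)),
      chartIdeal_isPrime (p i.rev).isIrreducible'.isPreirreducible (hhead _)⟩
  have hJ : StrictMono J := fun i j hij =>
    chartIdeal_lt (p j.rev).isClosed' (p i.rev).isIrreducible'.isPreirreducible (hhead _)
      (p.strictMono (Fin.rev_lt_rev.2 hij))
  have hlen := MvPolynomial.length_add_height_le (LTSeries.mk p.length J hJ)
  have hle : chartIdeal c Y ≤ (LTSeries.mk p.length J hJ).head.asIdeal := by
    refine chartIdeal_anti c ?_
    change (p (0 : Fin (p.length + 1)).rev : Set (G.compatibleBlackData A)) ⊆ Y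
    rw [Fin.rev_zero]
    exact hlast
  have h1 : (p.length : ℕ∞) + (Fintype.card (χ.Index ⊕ G.Black) : ℕ∞) ≤
      Nat.card (G.CoordIndex d) :=
    le_trans (add_le_add le_rfl (hheight.trans (Ideal.height_mono hle))) hlen
  have h2 : p.length + Fintype.card (χ.Index ⊕ G.Black) ≤ Nat.card (G.CoordIndex d) := by
    exact_mod_cast h1
  have h3 := hn χ l₁ hχ
  rw [Fintype.card_sum, ← Nat.card_eq_fintype_card, ← Nat.card_eq_fintype_card] at h2
  have h4 : p.length ≤ n := by omega
  exact_mod_cast h4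

end UpperBound

/-! ### The dimension is at least the expected one. -/

section LowerBound

theorem le_topologicalKrullDim [Fintype E] {A : G.White → ProjPoint d}
    {p : G.HyperplaneAssignment d} (hp : p ∈ G.compatibleBlackData A) {χ : G.EquationChoice d}
    (hχ : χ.AdmissibleAt p) {n : ℕ}
    (hn : n + (Nat.card χ.Index + Nat.card G.Black) ≤ Nat.card (G.CoordIndex d)) :
    n ≤ topologicalKrullDim (G.compatibleBlackData A) := by
  classical
  obtain ⟨Q, m, hQ, hpQ, hmem⟩ := χ.exists_mem_compatibleBlackData hp hχ
  choose k hk using χ.isMultihomogeneous_equation A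
  have : Fintype χ.Index := Fintype.ofFinite _
  obtain ⟨c, hc⟩ := G.exists_mem_chart p
  let f : χ.Index ⊕ G.Black → MvPolynomial (G.CoordIndex d) ℂ :=
    Sum.elim (χ.equation A) fun b => X (b, c b) - 1
  obtain ⟨s, rfl, hhead, hlast⟩ := exists_ltSeries_of_eval_eq_zero f (G.chartCoord c p) (fun i => by
    rcases i with i | b
    · exact ((hk i).eval_chartCoord_eq_zero_iff hc).2 (χ.eval_equation_eq_zero hp i)
    · simp [f, chartCoord_self hc]) n (by
    rwa [Fintype.card_sum, ← Nat.card_eq_fintype_card, ← Nat.card_eq_fintype_card])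
  let S (i : Fin (s.length + 1)) : Set (G.compatibleBlackData A) :=
    {l | l.1 ∈ G.chart c ∧ eval (G.chartCoord c l.1) Q ≠ 0 ∧
      ∀ P ∈ (s i).asIdeal, eval (G.chartCoord c l.1) P = 0}
  -- The ideal `s i` misses `Q`, since it vanishes at `p` and `Q` does not. By the Nullstellensatz
  -- `P * Q` is nonzero somewhere on its zero locus, and where `Q ≠ 0` such a zero is compatible
  -- black data. So only elements of `s i` vanish on all of `S i`, which yields both irreducibility
  -- and strictness of the chain.
  have hS (i : Fin (s.length + 1)) {P : MvPolynomial (G.CoordIndex d) ℂ}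
      (hP : P ∉ (s i).asIdeal) : ∃ l ∈ S i, eval (G.chartCoord c l.1) P ≠ 0 := by
    have hQs : Q ∉ (s i).asIdeal := fun h => by
      have h1 : eval (G.chartCoord c p) Q = 0 := hlast ((s.monotone (Fin.le_last i) : _ ≤ _) h)
      exact hpQ ((hQ.eval_chartCoord_eq_zero_iff hc).1 h1)
    have hPQ : P * Q ∉ (s i).asIdeal := fun h =>
      ((s i).isPrime.mem_or_mem h).elim hP hQs
    rw [← IsPrime.vanishingIdeal_zeroLocus (K := ℂ) (s i).asIdeal, mem_vanishingIdeal_iff] at hPQ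
    push Not at hPQ
    obtain ⟨x, hx, hxPQ⟩ := hPQ
    simp only [mem_zeroLocus_iff, aeval_eq_eval] at hx hxPQ
    have hf (j) : eval x (f j) = 0 := hx _ ((LTSeries.head_le s i) (hhead j))
    obtain ⟨l, hlc, rfl⟩ := exists_chartCoord_eq (c := c) (x := x) fun b => by
      have := hf (Sum.inr b)
      simpa [f, sub_eq_zero] using this
    rw [map_mul, mul_ne_zero_iff] at hxPQ
    have hlB : l ∈ G.compatibleBlackData A := hmem l
      (fun h => hxPQ.2 ((hQ.eval_chartCoord_eq_zero_iff hlc).2 h))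
      fun j => ((hk j).eval_chartCoord_eq_zero_iff hlc).1 (hf (Sum.inl j))
    exact ⟨⟨l, hlB⟩, ⟨hlc, hxPQ.2, hx⟩, hxPQ.1⟩
  have hirr (i : Fin (s.length + 1)) : IsIrreducible (S i) := by
    constructor
    · obtain ⟨l, hl, -⟩ := hS i (P := 1) fun h => (s i).isPrime.ne_top ((Ideal.eq_top_iff_one _).2 h)
      exact ⟨l, hl⟩
    · rintro _ _ ⟨U, hU, rfl⟩ ⟨V, hV, rfl⟩ ⟨l, hl, hlU⟩ ⟨l', hl', hlV⟩
      obtain ⟨P, a, hP, hlP, hPU⟩ := exists_multihomogeneous_of_isOpen hU hlU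
      obtain ⟨P', a', hP', hlP', hPV⟩ := exists_multihomogeneous_of_isOpen hV hlV
      have h1 : P ∉ (s i).asIdeal := fun h =>
        hlP ((hP.eval_chartCoord_eq_zero_iff hl.1).1 (hl.2.2 P h))
      have h2 : P' ∉ (s i).asIdeal := fun h =>
        hlP' ((hP'.eval_chartCoord_eq_zero_iff hl'.1).1 (hl'.2.2 P' h))
      obtain ⟨z, hz, hzP⟩ := hS i fun h => ((s i).isPrime.mem_or_mem h).elim h1 h2
      rw [map_mul, mul_ne_zero_iff] at hzP
      exact ⟨z, hz, hPU _ fun h => hzP.1 ((hP.eval_chartCoord_eq_zero_iff hz.1).2 h),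
        hPV _ fun h => hzP.2 ((hP'.eval_chartCoord_eq_zero_iff hz.1).2 h)⟩
  let Z (i : Fin (s.length + 1)) : TopologicalSpace.IrreducibleCloseds (G.compatibleBlackData A) :=
    ⟨closure (S i.rev), (hirr i.rev).closure, isClosed_closure⟩
  have hZ : StrictMono Z := by
    intro i j hij
    have hlt : s j.rev < s i.rev := s.strictMono (Fin.rev_lt_rev.2 hij)
    have hle : (s j.rev).asIdeal ≤ (s i.rev).asIdeal := hlt.le
    have hsub : S i.rev ⊆ S j.rev := fun l hl => ⟨hl.1, hl.2.1, fun P hP => hl.2.2 P (hle hP)⟩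
    refine lt_of_le_of_ne (show closure (S i.rev) ⊆ closure (S j.rev) from closure_mono hsub)
      fun h => ?_
    have h' : closure (S i.rev) = closure (S j.rev) :=
      congrArg TopologicalSpace.IrreducibleCloseds.carrier h
    obtain ⟨P, hPi, hPj⟩ := SetLike.exists_of_lt (show (s j.rev).asIdeal < (s i.rev).asIdeal from hlt)
    obtain ⟨l, hl, hlP⟩ := hS j.rev hPj
    have hlcl : l ∈ closure (S i.rev) := h' ▸ subset_closure hl
    obtain ⟨z, hzU, hz⟩ := mem_closure_iff.1 hlcl _
      ((isOpen_chart_inter c P).preimage continuous_subtype_val) ⟨hl.1, hlP⟩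
    exact hzU.2 (hz.2.2 P hPi)
  exact Order.LTSeries.length_le_krullDim (LTSeries.mk s.length Z hZ)

end LowerBound

/-! ### Counting variables and equations. -/

section Counting

/-- There are at most as many independent differentials as variables. Hence the expected dimension
is a natural number. -/
theorem EquationChoice.card_index_add_card_black_le [Fintype E] {A : G.White → ProjPoint d}
    {p : G.HyperplaneAssignment d} (hp : p ∈ G.compatibleBlackData A) {χ : G.EquationChoice d}
    (hli : LinearIndependent ℂ fun (i : χ.Index) (v : G.CoordIndex d) =>
      eval (G.homogCoord p) (pderiv v (χ.equation A i))) :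
    Nat.card χ.Index + Nat.card G.Black ≤ Nat.card (G.CoordIndex d) := by
  choose k hk using χ.isMultihomogeneous_equation A
  have : Fintype χ.Index := Fintype.ofFinite _
  obtain ⟨c, hc⟩ := G.exists_mem_chart p
  have := (linearIndependent_pderiv_chart hk (chartCoord_self hc) (fun i =>
    ((hk i).eval_chartCoord_eq_zero_iff hc).2
      (χ.eval_equation_eq_zero hp i))
    (linearIndependent_pderiv_chartCoord hk hc hli)).fintype_card_le_finrank
  rwa [Module.finrank_fintype_fun_eq_card, Fintype.card_sum, ← Nat.card_eq_fintype_card,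
    ← Nat.card_eq_fintype_card, ← Nat.card_eq_fintype_card] at this

theorem EquationChoice.AdmissibleAt.pivot_injective [Fintype E] {χ : G.EquationChoice d}
    {l : G.HyperplaneAssignment d} (hχ : χ.AdmissibleAt l) (w : G.White) :
    Function.Injective (χ.pivot w) := by
  classical
  intro e e' h
  by_contra hne
  refine hχ w ?_
  rw [eval_pivotMinor]
  exact Matrix.det_zero_of_column_eq hne fun i => by simp [h]

/-- Admissible pivots are distinct, which leaves `d + 2 - m` coordinates at a vertex of degree `m`;
the degrees of the white vertices sum to the number of edges. -/
theorem EquationChoice.AdmissibleAt.card_index [Fintype E] {χ : G.EquationChoice d}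
    {l : G.HyperplaneAssignment d} (hχ : χ.AdmissibleAt l) :
    (Nat.card χ.Index : ℤ) =
      (d + 2) * Nat.card G.White - Nat.card E + Nat.card G.Face - 1 := by
  classical
  have hw (w : G.White) : (Fintype.card {j : Fin (d + 1) // j ∉ Set.range (χ.pivot w)} : ℤ) =
      (d + 2) - Fintype.card (G.WhiteStar w) := by
    have h1 : Fintype.card {j : Fin (d + 1) // j ∉ Set.range (χ.pivot w)} =
        d + 1 - Fintype.card {e : G.WhiteStar w // e ≠ χ.drop w} := by
      have := Fintype.card_subtype_compl fun j => j ∈ Set.range (χ.pivot w)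
      rw [Fintype.card_fin] at this
      rw [← Set.card_range_of_injective (hχ.pivot_injective w)]
      convert this using 2
    have h2 : Fintype.card {e : G.WhiteStar w // e ≠ χ.drop w} =
        Fintype.card (G.WhiteStar w) - 1 := by
      have := Fintype.card_subtype_compl fun e => e = χ.drop w
      rw [Fintype.card_subtype_eq] at this
      convert this using 2
    have h3 : 0 < Fintype.card (G.WhiteStar w) := Fintype.card_pos_iff.2 ⟨χ.drop w⟩
    have h4 := Fintype.card_le_of_injective _ (hχ.pivot_injective w)
    rw [Fintype.card_fin] at h4
    omega
  have hE : ∑ w : G.White, (Fintype.card (G.WhiteStar w) : ℤ) = Fintype.card E := by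
    rw [← Nat.cast_sum, ← Fintype.card_sigma]
    exact congrArg _ (Fintype.card_congr (Equiv.sigmaFiberEquiv G.white))
  have hF : Fintype.card {F : G.Face // F ≠ χ.omitted} = Fintype.card G.Face - 1 := by
    have := Fintype.card_subtype_compl fun F => F = χ.omitted
    rw [Fintype.card_subtype_eq] at this
    convert this using 2
  have hF0 : 0 < Fintype.card G.Face := Fintype.card_pos_iff.2 ⟨χ.omitted⟩
  rw [Nat.card_sum, Nat.card_eq_fintype_card, Nat.card_eq_fintype_card, Fintype.card_sigma, hF]
  simp only [Nat.card_eq_fintype_card]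
  push_cast [Nat.cast_sub hF0]
  rw [Finset.sum_congr rfl fun w _ => hw w, Finset.sum_sub_distrib, hE]
  simp
  ring

end Counting

end BipartiteSurfaceGraph

end
theorem mainTheorem10 {E : Type*} [Fintype E] [Nonempty E] (G : BipartiteSurfaceGraph E)
    (hbalanced : Nat.card G.White = Nat.card G.Black)
    (d : ℕ) (hd : 2 ≤ d)
    (A : G.White → ProjPoint d) (hA : G.IsCircuitConfiguration A)
    (hne : (G.compatibleBlackData A).Nonempty)
    (hind : G.EquationsIndependent A) :
    (∃ n : ℕ, topologicalKrullDim (G.compatibleBlackData A) = (n : WithBot ℕ∞) ∧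
        (n : ℤ) = 1 - G.eulerChar) ∧
      (G.eulerChar = 0 → topologicalKrullDim (G.compatibleBlackData A) = 1) := by
  have hdim : ∃ n : ℕ, topologicalKrullDim (G.compatibleBlackData A) = (n : WithBot ℕ∞) ∧
      (n : ℤ) = 1 - G.eulerChar := by
    obtain ⟨l₀, hl₀⟩ := hne
    -- A dense subset of a nonempty set is nonempty. The lower bound is taken at such a point `p`;
    -- the upper bound may use other choices of equations, but their number is always the same.
    obtain ⟨p, -, hp, χ, hχ, hli⟩ := mem_closure_iff.1 (hind hl₀) Set.univ isOpen_univ trivial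
    have hcoord : Nat.card (G.CoordIndex d) = Nat.card G.Black * (d + 1) := by
      rw [Nat.card_prod, Nat.card_fin]
    have hcount (χ : G.EquationChoice d) (l : G.HyperplaneAssignment d) (hχ : χ.AdmissibleAt l) :
        (Nat.card (G.CoordIndex d) : ℤ) - (Nat.card χ.Index + Nat.card G.Black) =
          1 - G.eulerChar := by
      rw [hχ.card_index, hcoord, BipartiteSurfaceGraph.eulerChar, hbalanced]
      push_cast
      ring
    have hle := χ.card_index_add_card_black_le hp hli
    obtain ⟨n, hn⟩ := Nat.exists_eq_add_of_le' hle
    have hn' : (n : ℤ) = 1 - G.eulerChar := by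
      rw [← hcount χ p hχ, hn]
      push_cast
      ring
    refine ⟨n, le_antisymm (BipartiteSurfaceGraph.topologicalKrullDim_le hind fun χ' l hχ' => ?_)
      (BipartiteSurfaceGraph.le_topologicalKrullDim hp hχ hn.ge), hn'⟩
    have := hcount χ' l hχ'
    omega
  refine ⟨hdim, fun h => ?_⟩
  obtain ⟨n, hn, hn'⟩ := hdim
  rw [h, sub_zero] at hn'
  rw [hn, show n = 1 by exact_mod_cast hn']
  rfl
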